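/- Let $\overline{\mathcal G_1}$ be the collection of pairs $(G,T)$ where $G$ is a compact abelian group with a rotation-invariant metric giving its topology, whose group $\widehat G$ of continuous characters is isomorphic to the additive group of a (unital) subring of $\mathbb Q$ (so $G$ is a one-solenoid), and $T$ is a continuous automorphism of $G$. Two pairs $(G,T)$ and $(G',T')$ are regarded as the same if they are algebraically isomorphic, that is, if there is an isomorphism of topological groups $\phi\colon G\to G'$ with $\phi\circ T=T'\circ\phi$; all cardinalities below are cardinalities of sets of algebraic isomorphism classes. Let $m_G$ be the Haar probability measure, let $B_\epsilon$ be the open ball of radius $\epsilon$ around the identity, and let $$h(T)=\lim_{\epsilon\searrow0}\ \limsup_{n\to\infty}\ -\frac1n\log m_G\Big(\bigcap_{j=0}^{n-1}T^{-j}B_\epsilon\Big)$$ be the entropy of $T$. Let $\mathsf F_T(n)=|\{g\in G: T^ng=g\}|$. When $\mathsf F_T(n)<\infty$ for all $n\ge1$ we say that the zeta function of $T$ is defined, and it is the formal power series $\zeta_T(z)=\exp\sum_{n\ge1}\frac{\mathsf F_T(n)}{n}z^n$. Then: (1) for every $(G,T)\in\overline{\mathcal G_1}$, the class $\{(G',T')\in\overline{\mathcal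 G_1}: h(T')=h(T)\}$ is uncountable; (2) for every $(G,T)\in\overline{\mathcal G_1}$ whose zeta function is defined, the class of those $(G',T')\in\overline{\mathcal G_1}$ whose zeta function is defined and satisfies $\zeta_{T'}=\zeta_T$ is countable; (3) for every $(G,T)\in\overline{\mathcal G_1}$ whose zeta function is defined, the class of those $(G',T')\in\overline{\mathcal G_1}$ whose zeta function is defined and which satisfy both $\zeta_{T'}=\zeta_T$ and $h(T')=h(T)$ is finite. -/

import Mathlib

open MeasureTheory Filter Set

/-- A compact metric abelian group `carrier` (written multiplicatively), carrying a
rotation-invariant metric that gives its topology and its Borel `σ`-algebra, together with a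
continuous group automorphism `T`. -/
structure CompactGroupAut : Type 1 where
  carrier : Type
  [commGroup : CommGroup carrier]
  [metricSpace : MetricSpace carrier]
  [isTopologicalGroup : IsTopologicalGroup carrier]
  [compactSpace : CompactSpace carrier]
  [measurableSpace : MeasurableSpace carrier]
  [borelSpace : BorelSpace carrier]
  dist_mul_mul_left : ∀ a b c : carrier, dist (a * b) (a * c) = dist b c
  T : carrier ≃ₜ* carrier

namespace CompactGroupAut

attribute [instance] commGroup metricSpace isTopologicalGroup compactSpace measurableSpace
  borelSpace

/-- Algebraic isomorphism: a continuous isomorphism of groups that intertwines the two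
automorphisms. -/
def AlgIso (X Y : CompactGroupAut) : Prop :=
  ∃ φ : X.carrier ≃ₜ* Y.carrier, ∀ g, φ (X.T g) = Y.T (φ g)

theorem AlgIso.refl (X : CompactGroupAut) : AlgIso X X :=
  ⟨ContinuousMulEquiv.refl _, fun _ => rfl⟩

theorem AlgIso.symm {X Y : CompactGroupAut} (h : AlgIso X Y) : AlgIso Y X := by
  obtain ⟨φ, hφ⟩ := h
  refine ⟨φ.symm, fun g => ?_⟩
  apply φ.injective
  rw [hφ]
  simp

theorem AlgIso.trans {X Y Z : CompactGroupAut} (h : AlgIso X Y) (h' : AlgIso Y Z) :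
    AlgIso X Z := by
  obtain ⟨φ, hφ⟩ := h
  obtain ⟨ψ, hψ⟩ := h'
  exact ⟨φ.trans ψ, fun g => by simp [hφ, hψ]⟩

/-- The setoid of algebraic isomorphism. -/
def algIsoSetoid : Setoid CompactGroupAut where
  r := AlgIso
  iseqv := ⟨AlgIso.refl, AlgIso.symm, AlgIso.trans⟩

/-- The set of algebraic isomorphism classes of the systems in `𝒜`. -/
def isoClasses (𝒜 : Set CompactGroupAut) : Set (Quotient algIsoSetoid) :=
  Quotient.mk algIsoSetoid '' 𝒜

/-- Haar measure on the group, normalized to be a probability measure. -/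
noncomputable def haarProb (X : CompactGroupAut) : Measure X.carrier :=
  Measure.haarMeasure ⊤

/-- The points `x` with `T ^ j x` in the open `ε`-ball around the identity for all `0 ≤ j < n`. -/
def bowenBall (X : CompactGroupAut) (ε : ℝ) (n : ℕ) : Set X.carrier :=
  ⋂ j ∈ Finset.range n, (X.T)^[j] ⁻¹' Metric.ball 1 ε

/-- The entropy `lim_{ε ↘ 0} limsup_{n → ∞} -(1/n) log m (bowenBall ε n)`. The inner quantity
grows as `ε` decreases, so the limit as `ε ↘ 0` is the supremum over `ε > 0`. -/
noncomputable def entropy (X : CompactGroupAut) : EReal :=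
  ⨆ (ε : ℝ) (_ : 0 < ε),
    limsup (fun n : ℕ =>
      ((-(1 / (n : ℝ)) * Real.log (X.haarProb.real (X.bowenBall ε n)) : ℝ) : EReal)) atTop

/-- The points `g` with `T ^ n g = g`. -/
def periodicPoints (X : CompactGroupAut) (n : ℕ) : Set X.carrier :=
  {g | (X.T)^[n] g = g}

/-- All the numbers of periodic points are finite, so that the zeta function is defined. -/
def HasZeta (X : CompactGroupAut) : Prop :=
  ∀ n : ℕ, 1 ≤ n → (X.periodicPoints n).Finite

/-- The dynamical zeta function `exp (∑_{n ≥ 1} F(n) / n * z ^ n)` as a formal power series,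
where `F(n)` is the number of points fixed by `T ^ n`; it is meaningful under `HasZeta`. The
coefficient of `z ^ 0` in the exponent is `F(0) / 0 = 0`. -/
noncomputable def zeta (X : CompactGroupAut) : PowerSeries ℚ :=
  (PowerSeries.exp ℚ).subst
    (PowerSeries.mk fun n : ℕ => ((X.periodicPoints n).ncard : ℚ) / (n : ℚ))

/-- The systems `(G, T)` for which `G` is a one-solenoid whose dual group is a subring of `ℚ`:
the group of continuous characters of `G` is isomorphic to the additive group of a subring. -/
def subringSolenoids : Set CompactGroupAut :=
  {X | ∃ R : Subring ℚ, Nonempty (PontryaginDual X.carrier ≃* Multiplicative R)}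

end CompactGroupAut

/-! Pontryagin duality turns a system into a pair `(R, u)`: a subring `R` of `ℚ` and a unit `u` of
`R`, with `T` dual to multiplication by `u` (`exists_dualSubring`). Every pair occurs
(`dualSubringOfUnit`), equal pairs give isomorphic systems (`DualSubring.algIso`), and isomorphic
systems have the same `R`, because additively isomorphic subrings of `ℚ` coincide
(`Subring.eq_of_addEquiv`). A subring of `ℚ` is determined by the primes it inverts.

Entropy sees only the rational number `u`: if `u = a / b` in lowest terms, then `h(T) = log max(|a|,
|b|)` (`entropy_eq`). It does not see the primes inverted in `R` beyond those dividing `a * b`.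
These can be chosen freely, which gives uncountably many classes with the same entropy.

The zeta function sees `R`: it determines all the numbers `F(n)`, and `p` is invertible in `R`
exactly when `p` does not divide `F(p - 1)` (`inv_mem_iff_not_dvd_ncard`). If `p` is invertible, the
group has no `p`-torsion. Otherwise reduction mod `p` is a point of order `p`, and Fermat's little
theorem makes it fixed by `T ^ (p - 1)`. With `R` known, only the countably many units of `R`
remain. Fixing the entropy as well bounds numerator and denominator of `u`, leaving finitely many.
-/

/-! ### Characters separate the points of a compact metrizable abelian group. -/

/-- A commuting family of endomorphisms has a common eigenvector in every nonzero
finite-dimensional invariant subspace. -/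
theorem exists_common_eigenvector {ι K V : Type*} [Field K] [IsAlgClosed K] [AddCommGroup V]
    [Module K V] (T : ι → Module.End K V) (hc : ∀ i j v, T i (T j v) = T j (T i v)) (n : ℕ) :
    ∀ W : Submodule K V, FiniteDimensional K W → Module.finrank K W = n → W ≠ ⊥ →
      (∀ i, ∀ w ∈ W, T i w ∈ W) → ∃ v ∈ W, v ≠ 0 ∧ ∀ i, ∃ c : K, T i v = c • v := by
  induction n using Nat.strong_induction_on with
  | _ n ih =>
    intro W hfin hn hW hinv
    by_cases hs : ∀ i, ∃ c : K, ∀ w ∈ W, T i w = c • w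
    · obtain ⟨v, hv, hv0⟩ := Submodule.exists_mem_ne_zero_of_ne_bot hW
      exact ⟨v, hv, hv0, fun i => (hs i).imp fun c h => h v hv⟩
    · push Not at hs
      obtain ⟨i, hi⟩ := hs
      have : Nontrivial W := Submodule.nontrivial_iff_ne_bot.2 hW
      obtain ⟨c, hev⟩ := Module.End.exists_eigenvalue ((T i).restrict (hinv i))
      obtain ⟨u, hu⟩ := hev.exists_hasEigenvector
      have hu1 : T i u = c • (u : V) := congrArg Subtype.val hu.apply_eq_smul
      have hu2 : (u : V) ≠ 0 := fun h => hu.2 (Subtype.ext h)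
      -- An eigenspace of `T i` in `W` is invariant under the commuting family and is proper, since
      -- `T i` is not scalar on `W`; so induction on the dimension applies.
      let W' : Submodule K V := W ⊓ (T i).eigenspace c
      have hW' : W' ≠ ⊥ := fun h => hu2 <| (Submodule.eq_bot_iff _).1 h u
        ⟨u.2, Module.End.mem_eigenspace_iff.2 hu1⟩
      obtain ⟨w, hw, hwc⟩ := hi c
      have hlt : W' < W := lt_of_le_of_ne inf_le_left fun h =>
        hwc (Module.End.mem_eigenspace_iff.1 ((h ▸ hw : w ∈ W').2))
      have hfin' : FiniteDimensional K W' := Submodule.finiteDimensional_of_le hlt.le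
      obtain ⟨v, hv, hv0, hvc⟩ := ih _ (hn ▸ Submodule.finrank_lt_finrank_of_lt hlt) W' hfin' rfl
        hW' fun j w hw => ⟨hinv j w hw.1, Module.End.mem_eigenspace_iff.2 <| by
          rw [hc, Module.End.mem_eigenspace_iff.1 hw.2, map_smul]⟩
      exact ⟨v, hv.1, hv0, hvc⟩

section UnitaryRepresentation

variable {G H : Type*} [CommGroup G] [NormedAddCommGroup H] [InnerProductSpace ℂ H]

theorem inner_map_map_of_norm_map {π : G →* (H →L[ℂ] H)} (hiso : ∀ g v, ‖π g v‖ = ‖v‖) (g : G)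
    (u v : H) : inner ℂ (π g u) (π g v) = (inner ℂ u v : ℂ) :=
  (LinearMap.norm_map_iff_inner_map_map (π g)).1 (hiso g) u v

variable [TopologicalSpace G]

/-- A common eigenvector of a strongly continuous isometric representation gives a character. -/
theorem exists_character_of_eigenvector (π : G →* (H →L[ℂ] H)) (hiso : ∀ g v, ‖π g v‖ = ‖v‖)
    (hcont : ∀ v, Continuous fun g => π g v) {v : H} (hv : v ≠ 0)
    (hev : ∀ g, ∃ c : ℂ, π g v = c • v) :
    ∃ χ : G →ₜ* Circle, ∀ g, π g v = (χ g : ℂ) • v := by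
  choose c hc using hev
  have hinj : ∀ {a b : ℂ}, a • v = b • v → a = b := fun h => smul_left_injective ℂ hv h
  have hnorm : ∀ g, ‖c g‖ = 1 := fun g => by
    have := hiso g v
    rw [hc, norm_smul] at this
    exact (mul_eq_right₀ (norm_ne_zero_iff.2 hv)).1 this
  have hcc : Continuous c := by
    have h : c = fun g => (inner ℂ v (π g v)) / (inner ℂ v v : ℂ) := by
      funext g
      rw [hc, inner_smul_right, mul_div_cancel_right₀]
      exact inner_self_ne_zero.2 hv
    rw [h]
    exact (continuous_const.inner (hcont v)).div_const _
  refine ⟨{ toFun := fun g => ⟨c g, mem_sphere_zero_iff_norm.2 (hnorm g)⟩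
            map_one' := Subtype.ext <| hinj ?_
            map_mul' := fun g h => Subtype.ext <| hinj ?_
            continuous_toFun := hcc.subtype_mk _ }, hc⟩
  · rw [← hc, map_one]; simp
  · change c (g * h) • v = (c g * c h) • v
    rw [← hc, map_mul, mul_apply_eq_comp, hc, map_smul, hc, smul_smul, mul_comm]

variable [CompactSpace G] [MeasurableSpace G] [BorelSpace G]

open InnerProductSpace

/-- The average over a compact group of the rank one operators given by the orbit of `v`. -/
noncomputable def orbitAverage (μ : Measure G) (π : G →* (H →L[ℂ] H)) (v : H) : H →L[ℂ] H :=
  ∫ x, rankOne ℂ (π x v) (π x v) ∂μ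

variable {μ : Measure G} {π : G →* (H →L[ℂ] H)}

theorem integrable_rankOne_orbit [IsFiniteMeasure μ] (hcont : ∀ v, Continuous fun g => π g v)
    (v : H) : Integrable (fun x => rankOne ℂ (π x v) (π x v)) μ := by
  have h : Continuous fun x => rankOne ℂ (π x v) (π x v) :=
    ((ContinuousLinearMap.smulRightL ℂ H H).continuous.comp
      ((innerSL ℂ).continuous.comp (hcont v))).clm_apply (hcont v)
  exact h.integrable_of_hasCompactSupport (HasCompactSupport.of_compactSpace _)

variable [IsProbabilityMeasure μ]

theorem orbitAverage_apply (hcont : ∀ v, Continuous fun g => π g v) (v f : H) :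
    orbitAverage μ π v f = ∫ x, inner ℂ (π x v) f • π x v ∂μ := by
  rw [orbitAverage, ContinuousLinearMap.integral_apply (integrable_rankOne_orbit hcont v)]
  rfl

variable [CompleteSpace H]

theorem inner_orbitAverage (hcont : ∀ v, Continuous fun g => π g v) (v f h : H) :
    inner ℂ h (orbitAverage μ π v f) = ∫ x, inner ℂ h (π x v) * inner ℂ (π x v) f ∂μ := by
  rw [orbitAverage_apply hcont, ← integral_inner]
  · exact integral_congr_ae (Eventually.of_forall fun x => by simp [inner_smul_right, mul_comm])
  · exact (integrable_rankOne_orbit hcont v).apply_continuousLinearMap f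

theorem isCompactOperator_orbitAverage (hcont : ∀ v, Continuous fun g => π g v) (v : H) :
    IsCompactOperator (orbitAverage μ π v) := by
  have hclosed : IsClosed (compactOperator (RingHom.id ℂ) H H : Set (H →L[ℂ] H)) :=
    isClosed_setOfPred_isCompactOperator
  have hconv : Convex ℝ (compactOperator (RingHom.id ℂ) H H : Set (H →L[ℂ] H)) :=
    ((compactOperator (RingHom.id ℂ) H H).restrictScalars ℝ).convex
  refine hconv.integral_mem hclosed (Eventually.of_forall fun x => ?_)
    (integrable_rankOne_orbit hcont v)
  exact (isCompactOperator_of_locallyCompactSpace_dom (innerSL ℂ (π x v))).clm_comp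
    (ContinuousLinearMap.toSpanSingleton ℂ (π x v))

theorem isSymmetric_orbitAverage (hcont : ∀ v, Continuous fun g => π g v) (v : H) :
    (orbitAverage μ π v : H →ₗ[ℂ] H).IsSymmetric := by
  intro f h
  change inner ℂ (orbitAverage μ π v f) h = inner ℂ f (orbitAverage μ π v h)
  rw [← inner_conj_symm, inner_orbitAverage hcont, inner_orbitAverage hcont, ← integral_conj]
  refine integral_congr_ae (Eventually.of_forall fun x => ?_)
  simp only [map_mul, inner_conj_symm, mul_comm]

variable [IsTopologicalGroup G]

theorem orbitAverage_comm [μ.IsMulLeftInvariant] (hiso : ∀ g v, ‖π g v‖ = ‖v‖)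
    (hcont : ∀ v, Continuous fun g => π g v) (v f : H) (g : G) :
    orbitAverage μ π v (π g f) = π g (orbitAverage μ π v f) := by
  rw [orbitAverage_apply hcont, orbitAverage_apply hcont, ← ContinuousLinearMap.integral_comp_comm]
  · rw [← integral_mul_left_eq_self _ g]
    refine integral_congr_ae (Eventually.of_forall fun x => ?_)
    simp only [map_mul, mul_apply_eq_comp, map_smul, inner_map_map_of_norm_map hiso]
  · exact (integrable_rankOne_orbit hcont v).apply_continuousLinearMap f

/-- An element on which all characters are trivial acts trivially in every strongly continuous
isometric representation on a Hilbert space. -/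
theorem representation_eq_self_of_forall_character [μ.IsMulLeftInvariant] [μ.IsOpenPosMeasure]
    (hiso : ∀ g v, ‖π g v‖ = ‖v‖) (hcont : ∀ v, Continuous fun g => π g v) {a : G}
    (ha : ∀ χ : G →ₜ* Circle, χ a = 1) (v : H) : π a v = v := by
  have hcomm : ∀ g h w, π g (π h w) = π h (π g w) := fun g h w => by
    rw [← mul_apply_eq_comp, ← map_mul, mul_comm, map_mul, mul_apply_eq_comp]
  -- `K` is compact, self-adjoint and commutes with the representation, so its eigenspaces for
  -- nonzero eigenvalues are finite-dimensional and invariant.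
  set K := orbitAverage μ π v with hK
  have heig : ∀ c : ℂ, c ≠ 0 → ∀ w ∈ Module.End.eigenspace (K : Module.End ℂ H) c,
      π a w = w := by
    intro c hc
    set V := Module.End.eigenspace (K : Module.End ℂ H) c
    have hVfin : FiniteDimensional ℂ V :=
      ContinuousLinearMap.finite_dimensional_eigenspace
        (isCompactOperator_orbitAverage hcont v) c hc
    have hVinv : ∀ g, ∀ w ∈ V, π g w ∈ V := fun g w hw =>
      Module.End.mem_eigenspace_iff.2 <| by
        change K (π g w) = _
        rw [hK, orbitAverage_comm hiso hcont, ← hK,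
          show K w = c • w from Module.End.mem_eigenspace_iff.1 hw, map_smul]
    -- A common eigenvector `u` in the image of `π a - 1` is fixed by `π a`, as characters are
    -- trivial at `a`; but that image is orthogonal to the fixed vectors of the isometry `π a`, so
    -- `u = 0`.
    let D : H →ₗ[ℂ] H := (π a : H →ₗ[ℂ] H) - LinearMap.id
    have hD : ∀ w, D w = π a w - w := fun _ => rfl
    by_contra! hne
    obtain ⟨w, hw, hwa⟩ := hne
    have hWne : V.map D ≠ ⊥ := fun h => hwa <| sub_eq_zero.1 <|
      (Submodule.eq_bot_iff _).1 h _ (Submodule.mem_map_of_mem hw)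
    obtain ⟨u, hu, hu0, hue⟩ := exists_common_eigenvector (fun g => (π g : H →ₗ[ℂ] H)) hcomm _
      (V.map D) inferInstance rfl hWne (by
        rintro g _ ⟨w, hw, rfl⟩
        refine ⟨π g w, hVinv g w hw, ?_⟩
        change D (π g w) = π g (D w)
        rw [hD, hD, map_sub, hcomm])
    obtain ⟨χ, hχ⟩ := exists_character_of_eigenvector π hiso hcont hu0 hue
    have hua : π a u = u := by rw [hχ, ha]; simp
    obtain ⟨w, -, rfl⟩ := hu
    refine hu0 (inner_self_eq_zero (𝕜 := ℂ).1 ?_)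
    nth_rw 2 [hD]
    rw [inner_sub_right]
    nth_rw 1 [← hua]
    rw [inner_map_map_of_norm_map hiso, sub_self]
  -- The condition is closed and linear in `f` and holds on all eigenspaces, whose span is dense by
  -- the spectral theorem.
  have hall : ∀ f, π a (K f) = K f := by
    let S : Submodule ℂ H := LinearMap.ker (((π a - ContinuousLinearMap.id ℂ H).comp K :
      H →L[ℂ] H) : H →ₗ[ℂ] H)
    have hSmem : ∀ f, f ∈ S ↔ π a (K f) = K f := fun f => by
      exact sub_eq_zero (a := π a (K f)) (b := K f)
    have hSclosed : IsClosed (S : Set H) :=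
      ((π a - ContinuousLinearMap.id ℂ H).comp K).isClosed_ker
    have hle : (⨆ c, Module.End.eigenspace (K : Module.End ℂ H) c) ≤ S := by
      refine iSup_le fun c w hw => (hSmem w).2 ?_
      have hKw : K w = c • w := Module.End.mem_eigenspace_iff.1 hw
      by_cases hc : c = 0
      · simp [hKw, hc]
      · rw [hKw, map_smul, heig c hc w hw]
    have hbot : Sᗮ = ⊥ := le_bot_iff.1 <| (Submodule.orthogonal_le hle).trans
      (ContinuousLinearMap.orthogonalComplement_iSup_eigenspaces_eq_bot
        (isCompactOperator_orbitAverage hcont v) (isSymmetric_orbitAverage hcont v)).le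
    have : CompleteSpace S := hSclosed.completeSpace_coe
    have htop : S = ⊤ := (Submodule.orthogonal_eq_bot_iff).1 hbot
    exact fun f => (hSmem f).1 (htop ▸ Submodule.mem_top)
  -- Here `⟨w, K w⟩` is the integral of `|⟨π x v, w⟩| ^ 2`; a continuous nonnegative integrand with
  -- zero integral vanishes, in particular at `x = 1`.
  have hker : ∀ w, K w = 0 → inner ℂ v w = (0 : ℂ) := by
    intro w hw
    have hc : Continuous fun x => ‖(inner ℂ (π x v) w : ℂ)‖ ^ 2 :=
      (((hcont v).inner continuous_const).norm).pow 2
    have h1 : ∫ x, ‖(inner ℂ (π x v) w : ℂ)‖ ^ 2 ∂μ = 0 := by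
      have h2 := inner_orbitAverage (μ := μ) hcont v w w
      rw [← hK, hw, inner_zero_right] at h2
      have h3 : ∀ x, inner ℂ w (π x v) * inner ℂ (π x v) w
          = ((‖(inner ℂ (π x v) w : ℂ)‖ ^ 2 : ℝ) : ℂ) := fun x => by
        rw [← inner_conj_symm, Complex.conj_mul', Complex.ofReal_pow]
      simp_rw [h3] at h2
      rw [integral_complex_ofReal] at h2
      exact_mod_cast h2.symm
    rw [integral_eq_zero_iff_of_nonneg (fun x => by positivity)
      (hc.integrable_of_hasCompactSupport (HasCompactSupport.of_compactSpace _)),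
      hc.ae_eq_iff_eq μ continuous_zero] at h1
    simpa using congrFun h1 1
  have hinv : ∀ h, inner ℂ v (π a h) = (inner ℂ v h : ℂ) := fun h => by
    rw [← sub_eq_zero, ← inner_sub_right]
    exact hker _ (by rw [map_sub, hK, orbitAverage_comm hiso hcont, ← hK, hall, sub_self])
  have hπ : π a (π a⁻¹ v) = v := by
    rw [← mul_apply_eq_comp, ← map_mul, mul_inv_cancel, map_one]; rfl
  rw [← sub_eq_zero, ← inner_self_eq_zero (𝕜 := ℂ)]
  have hsub : π a v - v = π a (v - π a⁻¹ v) := by rw [map_sub, hπ]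
  nth_rw 2 [hsub]
  rw [inner_sub_left, inner_map_map_of_norm_map hiso, hinv, sub_self]

end UnitaryRepresentation

/-- The continuous characters of a compact metrizable abelian group separate points. -/
theorem exists_character_ne_one {G : Type*} [CommGroup G] [TopologicalSpace G]
    [IsTopologicalGroup G] [CompactSpace G] [T2Space G] [SecondCountableTopology G]
    {a : G} (ha : a ≠ 1) : ∃ χ : G →ₜ* Circle, χ a ≠ 1 := by
  by_contra! htriv
  borelize G
  let μ : Measure G := Measure.haarMeasure ⊤
  have : IsProbabilityMeasure μ :=
    ⟨by simpa [μ] using Measure.haarMeasure_self (K₀ := (⊤ : TopologicalSpace.PositiveCompacts G))⟩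
  -- The regular representation on `L²`: if all characters were trivial at `a`, translation by `a`
  -- would fix every function.
  let π : G →* (Lp ℂ 2 μ →L[ℂ] Lp ℂ 2 μ) :=
    { toFun := fun g => LinearMap.mkContinuous
        { toFun := fun f => DomMulAct.mk g • f
          map_add' := fun f h => smul_add _ _ _
          map_smul' := fun c f => smul_comm _ _ _ } 1 (fun f => by simp)
      map_one' := by ext1 f; simp
      map_mul' := fun g h => by
        ext1 f
        change DomMulAct.mk (g * h) • f = DomMulAct.mk g • DomMulAct.mk h • f
        rw [← mul_smul, mul_comm]
        rfl }
  have hπ : ∀ g f, π g f = DomMulAct.mk g • f := fun _ _ => rfl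
  have : Fact ((2 : ENNReal) ≠ ⊤) := ⟨ENNReal.ofNat_ne_top⟩
  have hfix := fun v => representation_eq_self_of_forall_character (μ := μ) (π := π)
    (fun g v => by rw [hπ]; simp) (fun v => by
      simp_rw [hπ]
      exact (continuous_id.smul continuous_const).comp DomMulAct.continuous_mk) htriv v
  obtain ⟨U, V, hU, hV, h1U, haV, hUV⟩ := t2_separation (Ne.symm ha)
  -- `W` is a neighbourhood of `1` disjoint from its translate by `a`, so its indicator is moved.
  let W : Set G := U ∩ (a • ·) ⁻¹' V
  have hWo : IsOpen W := hU.inter (hV.preimage (continuous_const_smul a))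
  have h1W : (1 : G) ∈ W := ⟨h1U, by simpa using haV⟩
  have hind := hfix (indicatorConstLp 2 hWo.measurableSet (measure_ne_top μ W) 1)
  rw [hπ, DomMulAct.mk_smul_indicatorConstLp] at hind
  refine (hWo.measure_pos μ ⟨1, h1W⟩).ne' (measure_eq_zero_iff_ae_notMem.2 ?_)
  have e1 := indicatorConstLp_coeFn (p := 2) (hs := hWo.measurableSet)
    (hμs := measure_ne_top μ W) (c := (1 : ℂ))
  have e2 := indicatorConstLp_coeFn (p := 2)
    (hs := hWo.measurableSet.preimage (measurable_const_smul a))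
    (hμs := measure_ne_top μ ((a • ·) ⁻¹' W)) (c := (1 : ℂ))
  rw [hind] at e2
  filter_upwards [e1, e2] with x h1 h2 hx
  rw [h1, indicator_of_mem hx, indicator_of_notMem] at h2
  · exact one_ne_zero h2
  · exact fun h => Set.disjoint_left.1 hUV h.1 hx.2

/-! ### Recovering a power series from its exponential. -/

/-- Differentiating gives `exp(f) * f' = exp(f) * g'`; the factor `exp(f)` cancels, and the constant
terms agree. -/
theorem powerSeries_exp_subst_injective {f g : PowerSeries ℚ}
    (hf : PowerSeries.constantCoeff f = 0) (hg : PowerSeries.constantCoeff g = 0)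
    (h : (PowerSeries.exp ℚ).subst f = (PowerSeries.exp ℚ).subst g) : f = g := by
  have hf' := PowerSeries.HasSubst.of_constantCoeff_zero' hf
  have hg' := PowerSeries.HasSubst.of_constantCoeff_zero' hg
  have hne : (PowerSeries.exp ℚ).subst f ≠ 0 := by
    have h1 := congrArg (PowerSeries.substAlgHom hf')
      (PowerSeries.exp_mul_exp_neg_eq_one (A := ℚ))
    rw [map_mul, map_one, PowerSeries.coe_substAlgHom] at h1
    exact left_ne_zero_of_mul_eq_one h1
  refine PowerSeries.derivative.ext (mul_left_cancel₀ hne ?_) (hf.trans hg.symm)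
  have e := congrArg (PowerSeries.derivative ℚ) h
  rwa [PowerSeries.derivative_subst hf', PowerSeries.derivative_subst hg',
    PowerSeries.derivative_exp, ← h] at e

/-! ### Subrings of `ℚ`. -/

namespace Subring

/-- Bézout: if `q = a / b` and `x * a + y * b = 1`, then `1 / b = x * q + y`. -/
theorem inv_den_mem {R : Subring ℚ} {q : ℚ} (hq : q ∈ R) : (q.den : ℚ)⁻¹ ∈ R := by
  have hb : (q.num.gcdA q.den) * q.num + (q.num.gcdB q.den) * q.den = 1 := by
    have h := Int.gcd_eq_gcd_ab q.num q.den
    have h1 : Int.gcd q.num q.den = 1 := q.reduced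
    rw [h1] at h
    push_cast at h
    linarith
  have hd : (q.den : ℚ) ≠ 0 := by exact_mod_cast q.den_nz
  have : (q.den : ℚ)⁻¹ = (q.num.gcdA q.den : ℤ) * q + (q.num.gcdB q.den : ℤ) := by
    rw [inv_eq_iff_eq_inv, eq_comm, inv_eq_iff_eq_inv, ← one_div, eq_div_iff hd, add_mul, mul_assoc,
      Rat.mul_den_eq_num]
    exact_mod_cast hb
  rw [this]
  exact R.add_mem (R.mul_mem (intCast_mem R _) hq) (intCast_mem R _)

theorem inv_mem_of_dvd {R : Subring ℚ} {m n : ℕ} (h0 : n ≠ 0) (hn : (n : ℚ)⁻¹ ∈ R) (h : m ∣ n) :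
    (m : ℚ)⁻¹ ∈ R := by
  obtain ⟨k, rfl⟩ := h
  have hk : (k : ℚ) ≠ 0 := by exact_mod_cast right_ne_zero_of_mul h0
  have hm : (m : ℚ) ≠ 0 := by exact_mod_cast left_ne_zero_of_mul h0
  have : (m : ℚ)⁻¹ = k * ((m * k : ℕ) : ℚ)⁻¹ := by
    push_cast
    field_simp
  rw [this]
  exact R.mul_mem (natCast_mem R _) hn

theorem inv_natCast_mem {R : Subring ℚ} (n : ℕ) (hn : n ≠ 0)
    (h : ∀ p : ℕ, p.Prime → p ∣ n → (p : ℚ)⁻¹ ∈ R) : (n : ℚ)⁻¹ ∈ R := by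
  induction n using Nat.recOnMul with
  | zero => exact absurd rfl hn
  | one => simp [R.one_mem]
  | prime p hp => exact h p hp dvd_rfl
  | mul a b ha hb =>
    rw [Nat.cast_mul, mul_inv]
    exact R.mul_mem (ha (left_ne_zero_of_mul hn) fun p hp hd => h p hp (hd.mul_right b))
      (hb (right_ne_zero_of_mul hn) fun p hp hd => h p hp (hd.mul_left a))

theorem mem_iff_forall_prime_inv_mem {R : Subring ℚ} {q : ℚ} :
    q ∈ R ↔ ∀ p : ℕ, p.Prime → p ∣ q.den → (p : ℚ)⁻¹ ∈ R := by
  refine ⟨fun hq p _ hd => inv_mem_of_dvd q.den_nz (inv_den_mem hq) hd, fun h => ?_⟩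
  rw [← Rat.num_div_den q, div_eq_mul_inv]
  exact R.mul_mem (intCast_mem R _) (inv_natCast_mem _ q.den_nz h)

theorem ext_of_prime_inv_mem {R S : Subring ℚ}
    (h : ∀ p : ℕ, p.Prime → ((p : ℚ)⁻¹ ∈ R ↔ (p : ℚ)⁻¹ ∈ S)) : R = S := by
  ext q
  rw [mem_iff_forall_prime_inv_mem, mem_iff_forall_prime_inv_mem]
  exact forall₃_congr fun p hp _ => h p hp

theorem addMonoidHom_apply {R : Subring ℚ} (f : R →+ ℚ) (q : R) : f q = q * f 1 := by
  have hd : ((q : ℚ).den : ℚ) ≠ 0 := by exact_mod_cast (q : ℚ).den_nz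
  have h : (q : ℚ).den • q = (q : ℚ).num • (1 : R) := by
    apply Subtype.ext
    simp
  have h' := congrArg f h
  rw [map_nsmul, map_zsmul, nsmul_eq_mul, zsmul_eq_mul] at h'
  have h2 : (q : ℚ) * (q : ℚ).den = (q : ℚ).num := Rat.mul_den_eq_num _
  apply mul_left_cancel₀ hd
  rw [h', ← h2]
  ring

/-- An additive map is multiplication by its value `φ 1`, so `φ` sends `q * φ.symm 1` to `q`.
Closure of `R` under products puts that preimage in `R`. -/
theorem eq_of_addEquiv {R S : Subring ℚ} (φ : R ≃+ S) : R = S := by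
  have key : ∀ {R S : Subring ℚ} (φ : R ≃+ S), R ≤ S := by
    intro R S φ q hq
    have hφ : ∀ x, (φ x : ℚ) = x * φ 1 := addMonoidHom_apply ((S.subtype : S →+ ℚ).comp (φ : R →+ S))
    have h1 : (1 : ℚ) = φ.symm 1 * φ 1 := by simpa using hφ (φ.symm 1)
    have h4 : q = φ (⟨q, hq⟩ * φ.symm 1) := by
      have h : (φ (⟨q, hq⟩ * φ.symm 1) : ℚ) = q * φ.symm 1 * φ 1 := hφ (⟨q, hq⟩ * φ.symm 1)
      rw [h, mul_assoc, ← h1, mul_one]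
    rw [h4]
    exact (φ _).2
  exact le_antisymm (key φ) (key φ.symm)

/-- Reduction modulo a prime that is not invertible in a subring of `ℚ`. -/
noncomputable def reduction (R : Subring ℚ) (p : ℕ) [hp : Fact p.Prime] (h : (p : ℚ)⁻¹ ∉ R) :
    R →+* ZMod p :=
  -- No denominator in `R` is divisible by `p`, so `R` embeds in the `p`-adic integers.
  PadicInt.toZMod.comp
    { toFun := fun q => (⟨(Rat.castHom ℚ_[p] (R.subtype q)), Padic.norm_rat_le_one fun hd =>
        h (mem_iff_forall_prime_inv_mem.1 q.2 p hp.out hd)⟩ : ℤ_[p])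
      map_one' := Subtype.ext (by simp)
      map_mul' := fun a b => Subtype.ext (map_mul ((Rat.castHom ℚ_[p]).comp R.subtype) a b)
      map_zero' := Subtype.ext (by simp)
      map_add' := fun a b => Subtype.ext (map_add ((Rat.castHom ℚ_[p]).comp R.subtype) a b) }

end Subring

/-! ### Duality between systems and pairs `(R, u)`. -/

/-- A continuous homomorphism from a compact group to the circle is surjective if none of its
nontrivial powers is trivial. -/
theorem surjective_of_forall_pow_ne_one {G : Type*} [Group G] [TopologicalSpace G]
    [CompactSpace G] (χ : G →ₜ* Circle)
    (h : ∀ m : ℤ, m ≠ 0 → ∃ x, χ x ^ m ≠ 1) : Function.Surjective χ := by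
  let S : AddSubgroup ℝ :=
    { carrier := {t | Circle.exp t ∈ range χ}
      zero_mem' := ⟨1, by simp⟩
      add_mem' := by
        rintro s t ⟨x, hx⟩ ⟨y, hy⟩
        exact ⟨x * y, by rw [map_mul, hx, hy, Circle.exp_add]⟩
      neg_mem' := by
        rintro s ⟨x, hx⟩
        exact ⟨x⁻¹, by rw [map_inv, hx, Circle.exp_neg]⟩ }
  have hS : ∀ t, t ∈ S ↔ Circle.exp t ∈ range χ := fun _ => Iff.rfl
  have hclosed : IsClosed (S : Set ℝ) :=
    (isCompact_range χ.continuous_toFun).isClosed.preimage Circle.exp.continuous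
  -- The closed subgroup `S` of `ℝ` is either everything or cyclic. If it is generated by `a`, then
  -- `2π = m * a` for some `m ≠ 0`, and the `m`-th power of `χ` is trivial.
  rcases S.dense_or_cyclic with hd | ⟨a, ha⟩
  · intro z
    obtain ⟨t, rfl⟩ := Circle.exp_surjective z
    have : t ∈ (S : Set ℝ) := by
      rw [← hclosed.closure_eq, hd.closure_eq]
      trivial
    exact this
  · exfalso
    have hmem : ∀ t, t ∈ S ↔ ∃ k : ℤ, k • a = t := fun t => by
      rw [ha, AddSubgroup.mem_closure_singleton]
    obtain ⟨m, hm⟩ := (hmem (2 * Real.pi)).1 ((hS _).2 ⟨1, by simp⟩)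
    have hm0 : m ≠ 0 := by
      rintro rfl
      simp [Real.pi_ne_zero] at hm
    obtain ⟨x, hx⟩ := h m hm0
    obtain ⟨t, ht⟩ := Circle.exp_surjective (χ x)
    obtain ⟨k, rfl⟩ := (hmem t).1 ((hS t).2 ⟨x, ht.symm⟩)
    refine hx ?_
    rw [← ht, ← Circle.exp_zsmul, smul_comm, hm, zsmul_eq_mul, Circle.exp_int_mul_two_pi]

namespace CompactGroupAut

/-- An identification of the dual of `X` with the additive group of a subring `R` of `ℚ`, under
which the automorphism of `X` is dual to multiplication by the unit `u`. -/
structure DualSubring (X : CompactGroupAut) (R : Subring ℚ) (u : Rˣ) where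
  equiv : Multiplicative R ≃* PontryaginDual X.carrier
  equiv_T : ∀ (q : R) (x : X.carrier), equiv (Multiplicative.ofAdd q) (X.T x) =
    equiv (Multiplicative.ofAdd (u * q)) x

/-- The transpose of `T` is an additive endomorphism of `R`, hence multiplication by its value at
`1`; the transpose of `T⁻¹` supplies the inverse. -/
theorem exists_dualSubring {X : CompactGroupAut} (hX : X ∈ subringSolenoids) :
    ∃ (R : Subring ℚ) (u : Rˣ), Nonempty (X.DualSubring R u) := by
  obtain ⟨R, ⟨e⟩⟩ := hX
  let F (S : X.carrier →ₜ* X.carrier) : R →+ R := MonoidHom.toAdditive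
    ((e : PontryaginDual X.carrier →* Multiplicative R).comp
      (((PontryaginDual.map S : PontryaginDual X.carrier →ₜ* PontryaginDual X.carrier) :
        PontryaginDual X.carrier →* PontryaginDual X.carrier).comp
        (e.symm : Multiplicative R →* PontryaginDual X.carrier)))
  have hF : ∀ S q, e.symm (Multiplicative.ofAdd (F S q)) =
      PontryaginDual.map S (e.symm (Multiplicative.ofAdd q)) := fun S q => e.symm_apply_apply _
  have hFm : ∀ S q, F S q = q * F S 1 := fun S q =>
    Subtype.ext (Subring.addMonoidHom_apply ((R.subtype : R →+ ℚ).comp (F S)) q)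
  have hinv : ∀ S S' : X.carrier →ₜ* X.carrier, (∀ x, S' (S x) = x) → F S (F S' 1) = 1 := by
    intro S S' h
    refine Multiplicative.ofAdd.injective (e.symm.injective ?_)
    rw [hF, hF]
    ext x
    simp [h]
  let T : X.carrier →ₜ* X.carrier := X.T
  let T' : X.carrier →ₜ* X.carrier := X.T.symm
  have h1 := hinv T T' (X.T.symm_apply_apply)
  have h2 := hinv T' T (X.T.apply_symm_apply)
  rw [hFm] at h1 h2
  refine ⟨R, ⟨F T 1, F T' 1, h2, h1⟩, ⟨⟨e.symm, fun q x => ?_⟩⟩⟩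
  change _ = e.symm (Multiplicative.ofAdd (F T 1 * q)) x
  rw [mul_comm, ← hFm, hF]
  rfl

namespace DualSubring

variable {X Y : CompactGroupAut} {R : Subring ℚ} {u : Rˣ} (D : X.DualSubring R u)

/-- The character corresponding to an element of the subring. -/
noncomputable def char (q : R) : X.carrier →ₜ* Circle := D.equiv (Multiplicative.ofAdd q)

theorem char_zero (x : X.carrier) : D.char 0 x = 1 := by
  have h : D.equiv (Multiplicative.ofAdd 0) = 1 := map_one D.equiv
  exact congrArg (fun χ : PontryaginDual X.carrier => χ x) h

theorem char_add (q r : R) (x : X.carrier) : D.char (q + r) x = D.char q x * D.char r x :=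
  congrArg (fun χ : PontryaginDual X.carrier => χ x)
    (map_mul D.equiv (Multiplicative.ofAdd q) (Multiplicative.ofAdd r))

theorem char_intCast_mul (m : ℤ) (q : R) (x : X.carrier) :
    D.char (m * q) x = D.char q x ^ m := by
  let f : Multiplicative R →* Circle :=
    { toFun := fun q => D.char q.toAdd x
      map_one' := D.char_zero x
      map_mul' := fun q r => D.char_add _ _ x }
  rw [← zsmul_eq_mul]
  exact map_zpow f (Multiplicative.ofAdd q) m

theorem char_natCast_mul (m : ℕ) (q : R) (x : X.carrier) :
    D.char (m * q) x = D.char q x ^ m := by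
  exact_mod_cast D.char_intCast_mul m q x

theorem char_T (q : R) (x : X.carrier) : D.char q (X.T x) = D.char (u * q) x := D.equiv_T q x

theorem char_iterate_T (n : ℕ) (q : R) (x : X.carrier) :
    D.char q (X.T^[n] x) = D.char ((u : R) ^ n * q) x := by
  induction n generalizing x with
  | zero => simp
  | succ n ih => rw [Function.iterate_succ_apply, ih, char_T, pow_succ', mul_assoc]

theorem exists_char_ne_one {q : R} (hq : q ≠ 0) : ∃ x, D.char q x ≠ 1 := by
  by_contra! h
  refine hq (Multiplicative.ofAdd.injective (D.equiv.injective ?_))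
  exact PontryaginDual.ext fun x => (h x).trans (D.char_zero x).symm

/-- `R` is torsion-free, so no power of this character with nonzero exponent is trivial. -/
theorem char_surjective {q : R} (hq : q ≠ 0) : Function.Surjective (D.char q) := by
  refine surjective_of_forall_pow_ne_one _ fun m hm => ?_
  obtain ⟨x, hx⟩ := D.exists_char_ne_one (mul_ne_zero (Int.cast_ne_zero.2 hm) hq)
  exact ⟨x, by rwa [← char_intCast_mul]⟩

theorem eq_of_forall_char_eq {x y : X.carrier} (h : ∀ q, D.char q x = D.char q y) : x = y := by
  rw [← div_eq_one]
  by_contra hne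
  obtain ⟨χ, hχ⟩ := exists_character_ne_one hne
  obtain ⟨q, rfl⟩ := D.equiv.surjective χ
  have h1 : D.char (Multiplicative.toAdd q) (x / y) = 1 := by rw [map_div, h, div_self']
  exact hχ h1

/-- Prescribing the value at one `1 / N` cuts out a nonempty closed set, by surjectivity of
characters. These sets are directed under multiplication of the `N`, so compactness gives a common
point, and the `1 / N` in `R` generate `R` additively. -/
theorem exists_forall_char_eq (ψ : Multiplicative R →* Circle) :
    ∃ x, ∀ q, D.char q x = ψ (Multiplicative.ofAdd q) := by
  let I := {N : ℕ // N ≠ 0 ∧ (N : ℚ)⁻¹ ∈ R}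
  let inv (N : I) : R := ⟨(N : ℚ)⁻¹, N.2.2⟩
  have hcast : ∀ (N : I), ((N : ℕ) : ℚ) ≠ 0 := fun N => Nat.cast_ne_zero.2 N.2.1
  have hψ : ∀ (m : ℤ) q, ψ (Multiplicative.ofAdd (m * q)) = ψ (Multiplicative.ofAdd q) ^ m :=
    fun m q => by rw [← zsmul_eq_mul, ofAdd_zsmul, map_zpow]
  let Z (N : I) : Set X.carrier := {x | D.char (inv N) x = ψ (Multiplicative.ofAdd (inv N))}
  have hstep : ∀ (N M : I) (m : ℤ), inv N = m * inv M → Z M ⊆ Z N := fun N M m h x hx => by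
    change _ = _ at hx
    change _ = _
    rw [h, char_intCast_mul, hψ, hx]
  have hclosed : ∀ N, IsClosed (Z N) := fun N =>
    isClosed_eq (D.char _).continuous_toFun continuous_const
  have : Nonempty I := ⟨⟨1, one_ne_zero, by simp [R.one_mem]⟩⟩
  obtain ⟨x, hx⟩ := IsCompact.nonempty_iInter_of_directed_nonempty_isCompact_isClosed Z
    (fun N M => by
      refine ⟨⟨N * M, mul_ne_zero N.2.1 M.2.1, ?_⟩, hstep _ _ M ?_, hstep _ _ N ?_⟩
      · rw [Nat.cast_mul, mul_inv]
        exact R.mul_mem N.2.2 M.2.2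
      · apply Subtype.ext
        have := hcast N
        have := hcast M
        simp [inv]
        field_simp
      · apply Subtype.ext
        have := hcast N
        have := hcast M
        simp [inv]
        field_simp)
    (fun N => D.char_surjective (fun h => inv_ne_zero (hcast N) (congrArg Subtype.val h)) _)
    (fun N => (hclosed N).isCompact) hclosed
  refine ⟨x, fun q => ?_⟩
  let N : I := ⟨(q : ℚ).den, (q : ℚ).den_nz, Subring.inv_den_mem q.2⟩
  have hq : q = (q : ℚ).num * inv N := by
    apply Subtype.ext
    simp [inv, N, ← div_eq_mul_inv, Rat.num_div_den]
  have hxN : D.char (inv N) x = ψ (Multiplicative.ofAdd (inv N)) := mem_iInter.1 hx N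
  rw [hq, char_intCast_mul, hψ, hxN]

/-- Both groups are identified with the homomorphisms from `R` to the circle. The characters embed
the target in a product of circles, which reduces continuity to that of each character. -/
theorem algIso (D : X.DualSubring R u) (D' : Y.DualSubring R u) : AlgIso X Y := by
  have hex : ∀ {X Y : CompactGroupAut} (D : X.DualSubring R u) (D' : Y.DualSubring R u)
      (x : X.carrier), ∃ y, ∀ q, D'.char q y = D.char q x := fun D D' x =>
    D'.exists_forall_char_eq
      { toFun := fun q => D.char q.toAdd x
        map_one' := D.char_zero x
        map_mul' := fun q r => D.char_add _ _ x }
  choose f hf using hex D D'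
  choose g hg using hex D' D
  have hcont : Continuous f := by
    have hemb : Topology.IsClosedEmbedding fun (y : Y.carrier) (q : R) => D'.char q y :=
      (continuous_pi fun q => (D'.char q).continuous_toFun).isClosedEmbedding
        fun y y' h => D'.eq_of_forall_char_eq fun q => congrFun h q
    refine hemb.isInducing.continuous_iff.2 (continuous_pi fun q => ?_)
    simp only [Function.comp_apply, hf]
    exact (D.char q).continuous_toFun
  let φ : X.carrier ≃ Y.carrier :=
    { toFun := f
      invFun := g
      left_inv := fun x => D.eq_of_forall_char_eq fun q => by rw [hg, hf]
      right_inv := fun y => D'.eq_of_forall_char_eq fun q => by rw [hf, hg] }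
  let φ' : X.carrier ≃ₜ Y.carrier := Continuous.homeoOfEquivCompactToT2 (f := φ) hcont
  refine ⟨{ φ' with
    map_mul' := fun x y => D'.eq_of_forall_char_eq fun q => ?_ }, fun x => ?_⟩
  · change D'.char q (f (x * y)) = D'.char q (f x * f y)
    rw [map_mul, hf, hf, hf, map_mul]
  · refine D'.eq_of_forall_char_eq fun q => ?_
    change D'.char q (f (X.T x)) = D'.char q (Y.T (f x))
    rw [hf, char_T, char_T, hf]

end DualSubring

/-! ### Periodic points and invertible primes. -/

/-- The points fixed by `T ^ n`, as a subgroup. -/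
def periodicSubgroup (X : CompactGroupAut) (n : ℕ) : Subgroup X.carrier where
  carrier := X.periodicPoints n
  one_mem' := iterate_map_one X.T n
  mul_mem' := fun {x y} hx hy => by
    change X.T^[n] (x * y) = x * y
    rw [iterate_map_mul, show X.T^[n] x = x from hx, show X.T^[n] y = y from hy]
  inv_mem' := fun {x} hx => by
    change X.T^[n] x⁻¹ = x⁻¹
    rw [iterate_map_inv, show X.T^[n] x = x from hx]

theorem natCard_periodicSubgroup (X : CompactGroupAut) (n : ℕ) :
    Nat.card (X.periodicSubgroup n) = (X.periodicPoints n).ncard :=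
  rfl

namespace DualSubring

variable {X : CompactGroupAut} {R : Subring ℚ} {u : Rˣ}

/-- The `p`-th power map is dual to multiplication by `p`, which is invertible on `R`. -/
theorem eq_one_of_pow_eq_one (D : X.DualSubring R u) {p : ℕ} (hp : p ≠ 0) (h : (p : ℚ)⁻¹ ∈ R)
    {x : X.carrier} (hx : x ^ p = 1) : x = 1 := by
  refine D.eq_of_forall_char_eq fun q => ?_
  have hq : q = (p : R) * (⟨(p : ℚ)⁻¹, h⟩ * q) := by
    apply Subtype.ext
    have : (p : ℚ) ≠ 0 := Nat.cast_ne_zero.2 hp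
    simp [← mul_assoc, this]
  rw [hq, char_natCast_mul, ← map_pow, hx, map_one, map_one]

/-- The point is `q ↦ exp(2πi (q mod p) / p)`. The unit `u` is nonzero mod `p`, so `u ^ (p - 1)`
reduces to `1`. -/
theorem exists_orderOf_eq (D : X.DualSubring R u) {p : ℕ} [Fact p.Prime] (h : (p : ℚ)⁻¹ ∉ R) :
    ∃ x ∈ X.periodicSubgroup (p - 1), orderOf x = p := by
  let r := Subring.reduction R p h
  obtain ⟨x, hx⟩ := D.exists_forall_char_eq
    ((ZMod.toCircle (N := p)).toMonoidHom.comp (AddMonoidHom.toMultiplicative (r : R →+ ZMod p)))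
  replace hx : ∀ q, D.char q x = ZMod.toCircle (r q) := hx
  refine ⟨x, D.eq_of_forall_char_eq fun q => ?_, orderOf_eq_prime ?_ ?_⟩
  · rw [char_iterate_T, hx, hx, map_mul, map_pow,
      ZMod.pow_card_sub_one_eq_one (u.isUnit.map r).ne_zero, one_mul]
  · refine D.eq_of_forall_char_eq fun q => ?_
    rw [map_pow, ← char_natCast_mul, hx, map_mul, map_natCast, ZMod.natCast_self, zero_mul,
      AddChar.map_zero_eq_one, map_one]
  · rintro rfl
    have h1 := hx 1
    rw [map_one, map_one, ← AddChar.map_zero_eq_one (ZMod.toCircle (N := p))] at h1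
    exact zero_ne_one (ZMod.injective_toCircle h1)

theorem inv_mem_iff_not_dvd_ncard (D : X.DualSubring R u) (hX : X.HasZeta) {p : ℕ} (hp : p.Prime) :
    (p : ℚ)⁻¹ ∈ R ↔ ¬ p ∣ (X.periodicPoints (p - 1)).ncard := by
  have : Fact p.Prime := ⟨hp⟩
  rw [← natCard_periodicSubgroup]
  constructor
  · intro h hd
    -- Cauchy's theorem needs finiteness: for an infinite group `Nat.card` takes the default value
    -- `0`, divisible by every `p`.
    have : Finite (X.periodicSubgroup (p - 1)) := hX _ (Nat.sub_pos_of_lt hp.one_lt)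
    obtain ⟨x, hx⟩ := exists_prime_orderOf_dvd_card' p hd
    rw [← Subgroup.orderOf_coe] at hx
    have h1 := D.eq_one_of_pow_eq_one hp.ne_zero h (hx ▸ pow_orderOf_eq_one (x : X.carrier))
    rw [h1, orderOf_one] at hx
    exact hp.one_lt.ne hx
  · intro hd
    by_contra h
    obtain ⟨x, hx, ho⟩ := D.exists_orderOf_eq h
    refine hd ?_
    have h1 : orderOf (⟨x, hx⟩ : X.periodicSubgroup (p - 1)) = p := by
      rw [← Subgroup.orderOf_coe, ho]
    have h2 := orderOf_dvd_natCard (⟨x, hx⟩ : X.periodicSubgroup (p - 1))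
    rwa [h1] at h2

end DualSubring

theorem ncard_periodicPoints_eq_of_zeta_eq {X Y : CompactGroupAut} (h : X.zeta = Y.zeta) {n : ℕ}
    (hn : n ≠ 0) : (X.periodicPoints n).ncard = (Y.periodicPoints n).ncard := by
  have h1 := powerSeries_exp_subst_injective (by simp) (by simp) h
  have h2 := congrArg (PowerSeries.coeff n) h1
  rw [PowerSeries.coeff_mk, PowerSeries.coeff_mk, div_left_inj' (Nat.cast_ne_zero.2 hn)] at h2
  exact_mod_cast h2

/-- The zeta function determines the dual group. -/
theorem DualSubring.subring_eq_of_zeta_eq {X Y : CompactGroupAut} {R S : Subring ℚ} {u : Rˣ}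
    {v : Sˣ} (D : X.DualSubring R u) (D' : Y.DualSubring S v) (hX : X.HasZeta) (hY : Y.HasZeta)
    (h : X.zeta = Y.zeta) : R = S :=
  Subring.ext_of_prime_inv_mem fun p hp => by
    rw [D.inv_mem_iff_not_dvd_ncard hX hp, D'.inv_mem_iff_not_dvd_ncard hY hp,
      ncard_periodicPoints_eq_of_zeta_eq h (Nat.sub_pos_of_lt hp.one_lt).ne']

end CompactGroupAut

/-! ### Entropy as the logarithm of the height. -/

/-- The Haar measure of a centered arc, pulled back along a surjective homomorphism. -/
theorem haar_real_preimage_centeredArc {G : Type*} [Group G] [TopologicalSpace G]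
    [IsTopologicalGroup G] [CompactSpace G] [MeasurableSpace G] [BorelSpace G] (μ : Measure G)
    [IsProbabilityMeasure μ] [μ.IsMulLeftInvariant] (χ : G →ₜ* Circle)
    (hχ : Function.Surjective χ) {δ : ℝ} (h0 : 0 ≤ δ) (hδ : δ ≤ Real.pi) :
    μ.real (χ ⁻¹' Circle.centeredArc δ) = δ / Real.pi := by
  have : Fact (0 < 2 * Real.pi) := ⟨Real.two_pi_pos⟩
  let g : G → AddCircle (2 * Real.pi) := fun x => AddCircle.homeomorphCircle'.symm (χ x)
  have hgc : Continuous g := AddCircle.homeomorphCircle'.symm.continuous.comp χ.continuous_toFun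
  have hcirc : ∀ x y : AddCircle (2 * Real.pi), AddCircle.homeomorphCircle' (x + y) =
      AddCircle.homeomorphCircle' x * AddCircle.homeomorphCircle' y := fun x y =>
    Real.Angle.toCircle_add x y
  have hg : ∀ x, AddCircle.homeomorphCircle' (g x) = χ x := fun x =>
    AddCircle.homeomorphCircle'.apply_symm_apply _
  have hgmul : ∀ x y, g (x * y) = g x + g y := fun x y => by
    apply AddCircle.homeomorphCircle'.injective
    rw [hcirc, hg, hg, hg, map_mul]
  let ν : Measure (AddCircle (2 * Real.pi)) := μ.map g
  have hνprob : IsProbabilityMeasure ν := Measure.isProbabilityMeasure_map hgc.aemeasurable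
  have hνinv : ν.IsAddLeftInvariant := ⟨fun y => by
    obtain ⟨h, hh⟩ := hχ (AddCircle.homeomorphCircle' y)
    have hy : g h = y := AddCircle.homeomorphCircle'.injective ((hg h).trans hh)
    rw [Measure.map_map (measurable_const_add y) hgc.measurable]
    have : (fun x => y + x) ∘ g = g ∘ fun x => h * x := by
      funext x
      simp [hgmul, hy]
    rw [this, ← Measure.map_map hgc.measurable (measurable_const_mul h), map_mul_left_eq_self]⟩
  -- Surjectivity of `χ` makes the push-forward invariant under all rotations, so uniqueness of Haar
  -- measure applies.
  have hν : ν = AddCircle.haarAddCircle := by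
    have := Measure.addHaarMeasure_unique ν ⊤
    simpa [AddCircle.haarAddCircle] using this
  let S : Set (AddCircle (2 * Real.pi)) := AddCircle.homeomorphCircle' ⁻¹' Circle.centeredArc δ
  have hSm : MeasurableSet S := ((Circle.isOpen_centeredArc δ).preimage
    AddCircle.homeomorphCircle'.continuous).measurableSet
  have hpre : χ ⁻¹' Circle.centeredArc δ = g ⁻¹' S := by
    ext x
    change _ ↔ AddCircle.homeomorphCircle' (g x) ∈ Circle.centeredArc δ
    rw [hg]
    rfl
  have hvol : volume S = ENNReal.ofReal (2 * δ) := by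
    rw [← (AddCircle.measurePreserving_mk (2 * Real.pi) (-Real.pi)).measure_preimage
      hSm.nullMeasurableSet, Measure.restrict_apply' measurableSet_Ioc]
    have : (QuotientAddGroup.mk ⁻¹' S : Set ℝ) ∩ Ioc (-Real.pi) (-Real.pi + 2 * Real.pi) =
        Ioo (-δ) δ := by
      ext t
      have hS : t ∈ (QuotientAddGroup.mk ⁻¹' S : Set ℝ) ↔
          Circle.exp t ∈ Circle.centeredArc δ := Iff.rfl
      rw [mem_inter_iff, hS, mem_Ioc, Circle.mem_centeredArc hδ, mem_Ioo, ← abs_lt]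
      constructor
      · rintro ⟨h, h1, h2⟩
        rwa [Circle.arg_exp h1 (by linarith)] at h
      · intro h
        have h' := abs_lt.1 h
        rw [Circle.arg_exp (by linarith) (by linarith)]
        exact ⟨h, by linarith, by linarith⟩
    rw [this, Real.volume_Ioo]
    congr 1
    ring
  rw [AddCircle.volume_eq_smul_haarAddCircle, Measure.smul_apply, smul_eq_mul] at hvol
  have hreal := congrArg ENNReal.toReal hvol
  rw [ENNReal.toReal_mul, ENNReal.toReal_ofReal Real.two_pi_pos.le,
    ENNReal.toReal_ofReal (by linarith)] at hreal
  rw [hpre, measureReal_def, ← Measure.map_apply hgc.measurable hSm, show μ.map g = ν from rfl,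
    hν, eq_div_iff Real.pi_ne_zero]
  linarith

/-- Points of the circle all of whose powers with exponents `a ^ j * b ^ (n - j)` are near `1`. -/
theorem forall_zpow_mem_centeredArc_iff {a b : ℤ} (ha : a ≠ 0) (hb : b ≠ 0) (hab : IsCoprime a b)
    {ε : ℝ} (hε : (|a| + |b|) * ε ≤ Real.pi) (n : ℕ) (z : Circle) :
    (∀ j ≤ n, z ^ (a ^ j * b ^ (n - j)) ∈ Circle.centeredArc ε) ↔
      z ∈ Circle.centeredArc (ε / (max |a| |b| : ℤ) ^ n) := by
  have hM1 : (1 : ℝ) ≤ (max |a| |b| : ℤ) := by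
    exact_mod_cast le_max_of_le_left (Int.one_le_abs ha)
  have hM : (0 : ℝ) < (max |a| |b| : ℤ) := by linarith
  have haM : (|(a : ℝ)|) ≤ (max |a| |b| : ℤ) := by exact_mod_cast le_max_left _ _
  have hbM : (|(b : ℝ)|) ≤ (max |a| |b| : ℤ) := by exact_mod_cast le_max_right _ _
  have ha' : (a : ℝ) ≠ 0 := Int.cast_ne_zero.2 ha
  have hb' : (b : ℝ) ≠ 0 := Int.cast_ne_zero.2 hb
  have ha0 : 0 < |(a : ℝ)| := abs_pos.2 ha'
  have hb0 : 0 < |(b : ℝ)| := abs_pos.2 hb'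
  set M : ℝ := ((max |a| |b| : ℤ) : ℝ) with hMdef
  constructor
  · induction n generalizing z with
    | zero => intro h; simpa using h 0 le_rfl
    | succ n ih =>
      intro h
      -- The exponents with `j ≥ 1` are those of `z ^ a` at level `n`, and those with `j ≤ n` are
      -- those of `z ^ b`.
      obtain ⟨s, hs, hsz⟩ := ih (z ^ a) fun j hj => by
        rw [← zpow_mul, show a * (a ^ j * b ^ (n - j)) = a ^ (j + 1) * b ^ (n + 1 - (j + 1)) by
          rw [Nat.add_sub_add_right]; ring]
        exact h _ (by omega)
      obtain ⟨t, ht, htz⟩ := ih (z ^ b) fun j hj => by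
        rw [← zpow_mul, show b * (a ^ j * b ^ (n - j)) = a ^ j * b ^ (n + 1 - j) by
          rw [Nat.sub_add_comm hj]; ring]
        exact h _ (by omega)
      simp only [mem_ofPred_eq] at hs ht
      have hε0 : 0 < ε := by
        by_contra hneg
        have : ε / M ^ n ≤ 0 := div_nonpos_of_nonpos_of_nonneg (not_lt.1 hneg) (by positivity)
        linarith [abs_nonneg s]
      have hle : ε / M ^ n ≤ ε := div_le_self hε0.le (one_le_pow₀ hM1)
      have hexp : Circle.exp (b * s) = Circle.exp (a * t) := by
        rw [Circle.exp_intCast_mul, Circle.exp_intCast_mul, hsz, htz, ← zpow_mul, ← zpow_mul,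
          mul_comm]
      -- Both sides lift `z ^ (a * b)` and differ by at most `(|a| + |b|) * ε ≤ π`, less than a full
      -- turn `2π`.
      have hbs : b * s = a * t := by
        obtain ⟨m, hm⟩ := Circle.exp_eq_exp.1 hexp
        have hm0 : m = 0 := by
          by_contra hm0
          have h1 : (1 : ℝ) ≤ |(m : ℝ)| := by exact_mod_cast Int.one_le_abs hm0
          have h2 : |(m : ℝ)| * (2 * Real.pi) = |b * s - a * t| := by
            rw [hm, add_sub_cancel_left, abs_mul, abs_of_pos Real.two_pi_pos]
          have h3 : |(b : ℝ) * s - a * t| ≤ |(b : ℝ)| * |s| + |(a : ℝ)| * |t| := by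
            rw [← abs_mul, ← abs_mul]
            exact abs_sub _ _
          have h4 : |(b : ℝ)| * |s| ≤ |(b : ℝ)| * ε := by gcongr; linarith
          have h5 : |(a : ℝ)| * |t| ≤ |(a : ℝ)| * ε := by gcongr; linarith
          push_cast at hε
          nlinarith [Real.pi_pos]
        simpa [hm0] using hm
      refine ⟨s / a, ?_, ?_⟩
      · have h1 : |s / a| * |(a : ℝ)| < ε / M ^ n := by
          rwa [← abs_mul, div_mul_cancel₀ _ ha']
        have h2 : |s / a| * |(b : ℝ)| < ε / M ^ n := by
          rwa [← abs_mul, div_mul_eq_mul_div, mul_comm s, hbs, mul_div_cancel_left₀ _ ha']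
        change |s / a| < ε / M ^ (n + 1)
        rw [pow_succ, ← div_div, lt_div_iff₀ hM]
        rcases max_choice |a| |b| with h | h
        · have hMa : M = |(a : ℝ)| := by rw [hMdef, h, Int.cast_abs]
          exact (congrArg (|s / a| * ·) hMa).trans_lt h1
        · have hMb : M = |(b : ℝ)| := by rw [hMdef, h, Int.cast_abs]
          exact (congrArg (|s / a| * ·) hMb).trans_lt h2
      · have h1 : Circle.exp (s / a) ^ a = z ^ a := by
          rw [← Circle.exp_intCast_mul, mul_div_cancel₀ _ ha', hsz]
        have h2 : Circle.exp (s / a) ^ b = z ^ b := by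
          rw [← Circle.exp_intCast_mul, ← mul_div_assoc, hbs, mul_div_cancel_left₀ _ ha', htz]
        -- `exp(s / a)` and `z` have the same `a`-th and `b`-th powers, so they agree by
        -- coprimality.
        obtain ⟨k, l, hkl⟩ := hab
        rw [← zpow_one (Circle.exp (s / a)), ← zpow_one z, ← hkl, zpow_add, zpow_add, mul_comm k,
          mul_comm l, zpow_mul, zpow_mul, zpow_mul, zpow_mul, h1, h2]
  · rintro ⟨t, ht, rfl⟩ j hj
    refine ⟨((a ^ j * b ^ (n - j) : ℤ) : ℝ) * t, ?_, Circle.exp_intCast_mul _ _⟩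
    change |t| < ε / M ^ n at ht
    change |((a ^ j * b ^ (n - j) : ℤ) : ℝ) * t| < ε
    rw [lt_div_iff₀ (by positivity)] at ht
    refine lt_of_le_of_lt ?_ ht
    rw [abs_mul, mul_comm]
    gcongr
    push_cast
    rw [abs_mul, abs_pow, abs_pow, ← Nat.add_sub_cancel' hj, pow_add, Nat.add_sub_cancel_left]
    gcongr

theorem tendsto_neg_inv_mul_log {c M : ℝ} (hc : 0 < c) (hM : 0 < M) :
    Tendsto (fun n : ℕ => -(1 / (n : ℝ)) * Real.log (c / M ^ (n - 1))) atTop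
      (nhds (Real.log M)) := by
  have h : Tendsto (fun n : ℕ => Real.log M - (Real.log c + Real.log M) * (1 / (n : ℝ))) atTop
      (nhds (Real.log M - (Real.log c + Real.log M) * 0)) :=
    (tendsto_one_div_atTop_nhds_zero_nat.const_mul _).const_sub _
  rw [mul_zero, sub_zero] at h
  refine h.congr' ?_
  filter_upwards [eventually_ge_atTop 1] with n hn
  obtain ⟨m, rfl⟩ := Nat.exists_eq_add_of_le' hn
  have : ((m + 1 : ℕ) : ℝ) ≠ 0 := by positivity
  rw [Real.log_div hc.ne' (by positivity), Real.log_pow, Nat.add_sub_cancel]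
  field_simp
  push_cast
  ring

namespace CompactGroupAut

instance (X : CompactGroupAut) : X.haarProb.IsHaarMeasure := by
  unfold haarProb
  infer_instance

instance (X : CompactGroupAut) : IsProbabilityMeasure X.haarProb :=
  ⟨by simpa [haarProb] using
    Measure.haarMeasure_self (K₀ := (⊤ : TopologicalSpace.PositiveCompacts X.carrier))⟩

theorem mem_bowenBall {X : CompactGroupAut} {ε : ℝ} {n : ℕ} {x : X.carrier} :
    x ∈ X.bowenBall ε n ↔ ∀ j < n, X.T^[j] x ∈ Metric.ball 1 ε := by
  simp [bowenBall]

theorem haarProb_real_bowenBall_pos (X : CompactGroupAut) {ε : ℝ} (hε : 0 < ε) (n : ℕ) :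
    0 < X.haarProb.real (X.bowenBall ε n) := by
  have hopen : IsOpen (X.bowenBall ε n) :=
    isOpen_biInter_finset fun j _ => Metric.isOpen_ball.preimage (X.T.continuous.iterate j)
  refine ENNReal.toReal_pos (hopen.measure_pos _ ⟨1, mem_bowenBall.2 fun j _ => ?_⟩).ne'
    (measure_ne_top _ _)
  rw [iterate_map_one]
  exact Metric.mem_ball_self hε

namespace DualSubring

variable {X : CompactGroupAut} {R : Subring ℚ} {u : Rˣ}

/-- The height of a unit of a subring of `ℚ`. -/
def height (u : Rˣ) : ℤ := max |((u : R) : ℚ).num| |(((u : R) : ℚ).den : ℤ)|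

theorem height_pos (u : Rˣ) : 0 < height u :=
  lt_max_of_lt_right (abs_pos.2 (Int.natCast_ne_zero.2 (Rat.den_nz _)))

theorem num_ne_zero (u : Rˣ) : ((u : R) : ℚ).num ≠ 0 := by
  rw [Rat.num_ne_zero]
  exact fun h => u.ne_zero (Subtype.ext h)

/-- The orbit segments that stay in the preimage of an arc under a character. -/
theorem haarProb_real_forall_char_iterate_mem (D : X.DualSubring R u) {q : R} (hq : q ≠ 0) {ε : ℝ}
    (h0 : 0 < ε) (hε : (|((u : R) : ℚ).num| + |(((u : R) : ℚ).den : ℤ)|) * ε ≤ Real.pi) (n : ℕ) :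
    X.haarProb.real {x | ∀ j ≤ n, D.char q (X.T^[j] x) ∈ Circle.centeredArc ε} =
      ε / Real.pi / (height u) ^ n := by
  set a := ((u : R) : ℚ).num
  set b : ℤ := ((((u : R) : ℚ).den : ℕ) : ℤ) with hb
  have hb0 : b ≠ 0 := Int.natCast_ne_zero.2 (Rat.den_nz _)
  have hbQ : (b : ℚ) ≠ 0 := Int.cast_ne_zero.2 hb0
  have hbQ' : (((u : R) : ℚ).den : ℚ) ≠ 0 := Nat.cast_ne_zero.2 (Rat.den_nz _)
  let w : R := ⟨(((u : R) : ℚ).den : ℚ)⁻¹, Subring.inv_den_mem (u : R).2⟩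
  have hbw : (b : R) * w = 1 := by
    apply Subtype.ext
    simp [hb, w, hbQ']
  have haw : (u : R) = a * w := by
    apply Subtype.ext
    simp only [w, Subring.coe_mul, Subring.coe_intCast]
    rw [← div_eq_mul_inv, Rat.num_div_den]
  have hw : w ≠ 0 := right_ne_zero_of_mul (hbw ▸ one_ne_zero)
  -- With `u = a / b` and `w = 1 / b`, all the characters `u ^ j * q` along the orbit segment are
  -- integer powers of the single character `w ^ n * q`.
  have hexp : ∀ j ≤ n, (u : R) ^ j * q = ((a ^ j * b ^ (n - j) : ℤ) : R) * (w ^ n * q) := by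
    intro j hj
    obtain ⟨k, rfl⟩ := Nat.exists_eq_add_of_le hj
    rw [Nat.add_sub_cancel_left, haw, pow_add]
    push_cast
    calc ((a : R) * w) ^ j * q = (a : R) ^ j * w ^ j * q * 1 ^ k := by ring
      _ = _ := by rw [← hbw]; ring
  have hset : {x | ∀ j ≤ n, D.char q (X.T^[j] x) ∈ Circle.centeredArc ε} =
      D.char (w ^ n * q) ⁻¹' Circle.centeredArc (ε / (height u) ^ n) := by
    ext x
    rw [mem_preimage, height, ← forall_zpow_mem_centeredArc_iff (num_ne_zero u) hb0 ?_ ?_ n]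
    · refine forall₂_congr fun j hj => ?_
      rw [char_iterate_T, hexp j hj, char_intCast_mul]
    · rw [Int.isCoprime_iff_gcd_eq_one]
      exact ((u : R) : ℚ).reduced
    · exact_mod_cast hε
  have hM : (1 : ℝ) ≤ height u := by exact_mod_cast height_pos u
  have hab : (1 : ℝ) ≤ |a| + |b| := by
    have h1 := abs_nonneg a
    have h2 := Int.one_le_abs hb0
    exact_mod_cast (by omega : (1 : ℤ) ≤ |a| + |b|)
  rw [hset, haar_real_preimage_centeredArc _ _
    (D.char_surjective (mul_ne_zero (pow_ne_zero n hw) hq)) (by positivity), div_right_comm]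
  refine (div_le_self h0.le (one_le_pow₀ hM)).trans (le_trans ?_ hε)
  push_cast at hab ⊢
  nlinarith

/-- Closed arc conditions on the characters `1 / N` form a directed family of compact sets with
intersection `{1}`, so by compactness one of them lies in the ball. This bounds the entropy from
above by a single character. -/
theorem exists_char_preimage_subset_ball (D : X.DualSubring R u) {ε : ℝ} (hε : 0 < ε) :
    ∃ q : R, q ≠ 0 ∧ ∃ δ > 0, ∀ x, D.char q x ∈ Circle.centeredArc δ → x ∈ Metric.ball 1 ε := by
  let I := {N : ℕ // N ≠ 0 ∧ (N : ℚ)⁻¹ ∈ R}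
  let inv (N : I) : R := ⟨(N : ℚ)⁻¹, N.2.2⟩
  have hcast : ∀ (N : I), ((N : ℕ) : ℚ) ≠ 0 := fun N => Nat.cast_ne_zero.2 N.2.1
  let Z (i : I × {δ : ℝ // 0 < δ}) : Set X.carrier :=
    D.char (inv i.1) ⁻¹' (Circle.exp '' Icc (-i.2) i.2)
  have hclosed : ∀ i, IsClosed (Z i) := fun i =>
    (isCompact_Icc.image Circle.exp.continuous).isClosed.preimage (D.char _).continuous_toFun
  have hstep : ∀ (N M : I) (m : ℕ) (δ δ' : {δ : ℝ // 0 < δ}), inv N = m * inv M →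
      m * (δ' : ℝ) ≤ δ → Z (M, δ') ⊆ Z (N, δ) := by
    rintro N M m δ δ' h hδ x ⟨t, ht, htx⟩
    refine ⟨m * t, ?_, ?_⟩
    · rw [mem_Icc, ← abs_le] at ht ⊢
      rw [abs_mul, Nat.abs_cast]
      exact (mul_le_mul_of_nonneg_left ht (Nat.cast_nonneg m)).trans hδ
    · rw [h, char_natCast_mul, ← htx, Circle.exp_natCast_mul]
  have : Nonempty (I × {δ : ℝ // 0 < δ}) :=
    ⟨⟨1, one_ne_zero, by simp [R.one_mem]⟩, ⟨1, one_pos⟩⟩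
  obtain ⟨⟨N, δ⟩, hi⟩ := exists_subset_nhds_of_isCompact (V := Z)
    (fun i i' => by
      have hN : (0 : ℝ) < (i.1 : ℕ) := Nat.cast_pos.2 (Nat.pos_of_ne_zero i.1.2.1)
      have hN' : (0 : ℝ) < (i'.1 : ℕ) := Nat.cast_pos.2 (Nat.pos_of_ne_zero i'.1.2.1)
      have hδ := i.2.2
      have hδ' := i'.2.2
      have hQ := hcast i.1
      have hQ' := hcast i'.1
      refine ⟨(⟨i.1 * i'.1, mul_ne_zero i.1.2.1 i'.1.2.1, ?_⟩,
        ⟨min (i.2 / (i'.1 : ℕ)) (i'.2 / (i.1 : ℕ)), by positivity⟩),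
        hstep _ _ i'.1 _ _ ?_ ?_, hstep _ _ i.1 _ _ ?_ ?_⟩
      · rw [Nat.cast_mul, mul_inv]
        exact R.mul_mem i.1.2.2 i'.1.2.2
      · apply Subtype.ext
        simp [inv]
        field_simp
      · rw [← le_div_iff₀' hN']
        exact min_le_left _ _
      · apply Subtype.ext
        simp [inv]
        field_simp
      · rw [← le_div_iff₀' hN]
        exact min_le_right _ _)
    (fun i => (hclosed i).isCompact)
    (U := Metric.ball 1 ε) (by
      intro x hx
      suffices h : x = 1 by
        rw [h]
        exact Metric.ball_mem_nhds _ hε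
      have hN : ∀ N, D.char (inv N) x = 1 := by
        intro N
        by_contra hne
        have harg : 0 < |(D.char (inv N) x : ℂ).arg| :=
          abs_pos.2 fun h => hne (Circle.arg_eq_zero.1 h)
        -- The arc of half the size of the argument excludes a nontrivial value.
        obtain ⟨t, ht, htx⟩ := mem_iInter.1 hx (N, ⟨_, half_pos harg⟩)
        have ht' := abs_le.2 ht
        have hpi := Complex.abs_arg_le_pi (D.char (inv N) x : ℂ)
        have htpi := abs_lt.1 (show |t| < Real.pi by linarith [Real.pi_pos])
        have := Circle.arg_exp htpi.1 htpi.2.le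
        rw [htx] at this
        rw [← this] at ht'
        linarith
      refine D.eq_of_forall_char_eq fun q => ?_
      let N : I := ⟨(q : ℚ).den, (q : ℚ).den_nz, Subring.inv_den_mem q.2⟩
      have hq : q = (q : ℚ).num * inv N := by
        apply Subtype.ext
        simp [inv, N, ← div_eq_mul_inv, Rat.num_div_den]
      rw [hq, char_intCast_mul, hN, one_zpow, map_one])
  exact ⟨inv N, fun h => inv_ne_zero (hcast N) (congrArg Subtype.val h), δ, δ.2, fun x hx =>
    hi (by
      obtain ⟨t, ht, htx⟩ := hx
      exact ⟨t, abs_le.1 (le_of_lt ht), htx⟩)⟩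

/-- The entropy is the logarithm of the height of the dual rational number. -/
theorem entropy_eq (D : X.DualSubring R u) :
    X.entropy = ((Real.log (height u) : ℝ) : EReal) := by
  have hM : (0 : ℝ) < height u := Int.cast_pos.2 (height_pos u)
  obtain ⟨C, hC⟩ : ∃ C : ℤ, |((u : R) : ℚ).num| + |(((u : R) : ℚ).den : ℤ)| = C := ⟨_, rfl⟩
  have hC0 : (0 : ℝ) < C := by
    have h1 : 0 < |((u : R) : ℚ).num| := abs_pos.2 (num_ne_zero u)
    exact_mod_cast hC ▸ add_pos_of_pos_of_nonneg h1 (abs_nonneg _)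
  have hmeas : ∀ {q : R} (hq : q ≠ 0) {ε : ℝ} (h0 : 0 < ε) (hε : C * ε ≤ Real.pi) (n : ℕ),
      X.haarProb.real {x | ∀ j ≤ n, D.char q (X.T^[j] x) ∈ Circle.centeredArc ε} =
        ε / Real.pi / (height u) ^ n := fun hq ε h0 hε n =>
    D.haarProb_real_forall_char_iterate_mem hq h0 (by
      rw [← hC] at hε
      exact_mod_cast hε) n
  -- The exponent is `n - 1` because `bowenBall` runs over `j < n`, while the measure formula runs
  -- over `j ≤ n`.
  have hlim : ∀ {ε : ℝ}, 0 < ε → limsup (fun n : ℕ =>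
      ((-(1 / (n : ℝ)) * Real.log (ε / Real.pi / (height u) ^ (n - 1)) : ℝ) : EReal)) atTop =
        ((Real.log (height u) : ℝ) : EReal) := fun {ε} hε =>
    ((continuous_coe_real_ereal.tendsto _).comp
      (tendsto_neg_inv_mul_log (div_pos hε Real.pi_pos) hM)).limsup_eq
  have hmono : ∀ {n : ℕ} {s t : ℝ}, 0 < s → s ≤ t → ((-(1 / (n : ℝ)) * Real.log t : ℝ) : EReal) ≤
      ((-(1 / (n : ℝ)) * Real.log s : ℝ) : EReal) := fun {n s t} hs hst => by
    rw [EReal.coe_le_coe_iff]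
    have h1 := Real.log_le_log hs hst
    have h2 : 0 ≤ 1 / (n : ℝ) := by positivity
    nlinarith
  apply le_antisymm
  · refine iSup₂_le fun ε hε => ?_
    obtain ⟨q, hq, δ', hδ', hsub⟩ := D.exists_char_preimage_subset_ball hε
    -- The bound `π / C` is the condition excluding wrap-around in `hmeas`.
    let δ := min δ' (Real.pi / C)
    have hδ : 0 < δ := lt_min hδ' (by positivity)
    have hδC : C * δ ≤ Real.pi := (le_div_iff₀' hC0).1 (min_le_right _ _)
    rw [← hlim hδ]
    refine limsup_le_limsup ?_
    filter_upwards [eventually_ge_atTop 1] with n hn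
    refine hmono (by positivity) ?_
    rw [← hmeas hq hδ hδC]
    refine measureReal_mono fun x hx => mem_bowenBall.2 fun j hj => hsub _ ?_
    exact Circle.centeredArc_mono (min_le_left _ _) (hx j (Nat.le_sub_one_of_lt hj))
  -- For the lower bound, a small ball lies in an arc preimage under the character `1`, by
  -- continuity.
  · have hδ : 0 < Real.pi / C := by positivity
    have hδC : C * (Real.pi / C) ≤ Real.pi := (mul_div_cancel₀ _ hC0.ne').le
    have hopen : IsOpen (D.char 1 ⁻¹' Circle.centeredArc (Real.pi / C)) :=
      (Circle.isOpen_centeredArc _).preimage (D.char 1).continuous_toFun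
    obtain ⟨ε, hε, hball⟩ := Metric.isOpen_iff.1 hopen 1 (by
      rw [mem_preimage, map_one]
      exact ⟨0, by simpa using hδ, Circle.exp_zero⟩)
    refine le_iSup₂_of_le ε hε ?_
    rw [← hlim hδ]
    refine limsup_le_limsup ?_
    filter_upwards [eventually_ge_atTop 1] with n hn
    refine hmono (X.haarProb_real_bowenBall_pos hε n) ?_
    rw [← hmeas one_ne_zero hδ hδC]
    exact measureReal_mono fun x hx j hj => hball (mem_bowenBall.1 hx j (by omega))

end DualSubring
end CompactGroupAut

/-! ### A model for every pair `(R, u)`. -/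

/-- The group of homomorphisms from the additive group of a subring of `ℚ` to the circle. -/
def CharGroup (R : Subring ℚ) : Type := Multiplicative R →* Circle

namespace CharGroup

variable (R : Subring ℚ)

noncomputable instance : CommGroup (CharGroup R) :=
  inferInstanceAs (CommGroup (Multiplicative R →* Circle))

/-- The values of a homomorphism. -/
noncomputable def eval (q : R) : CharGroup R →* Circle where
  toFun f := (show Multiplicative R →* Circle from f) (Multiplicative.ofAdd q)
  map_one' := rfl
  map_mul' _ _ := rfl

variable {R}

theorem ext {f g : CharGroup R} (h : ∀ q, eval R q f = eval R q g) : f = g :=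
  MonoidHom.ext h

variable (R)

/-- Since `R` is countable, a weighted sum of circle distances metrizes pointwise convergence;
rotation invariance of the circle metric then passes to it. -/
noncomputable instance : MetricSpace (CharGroup R) :=
  letI : Encodable R := Encodable.ofCountable R
  letI : MetricSpace (R → Circle) := PiCountable.metricSpace
  MetricSpace.induced (fun f q => eval R q f) (fun _ _ h => ext fun q => congrFun h q) inferInstance

theorem isInducing_eval : Topology.IsInducing fun (f : CharGroup R) (q : R) => eval R q f := ⟨rfl⟩

theorem continuous_eval (q : R) : Continuous (eval R q) :=
  (continuous_apply q).comp (isInducing_eval R).continuous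

theorem continuous_iff {Z : Type*} [TopologicalSpace Z] {f : Z → CharGroup R} :
    Continuous f ↔ ∀ q, Continuous fun z => eval R q (f z) :=
  (isInducing_eval R).continuous_iff.trans continuous_pi_iff

instance : IsTopologicalGroup (CharGroup R) where
  continuous_mul := (continuous_iff R).2 fun q => by
    simp only [map_mul]
    exact ((continuous_eval R q).comp continuous_fst).mul
      ((continuous_eval R q).comp continuous_snd)
  continuous_inv := (continuous_iff R).2 fun q => by
    simp only [map_inv]
    exact (continuous_eval R q).inv

theorem eval_zero (f : CharGroup R) : eval R 0 f = 1 :=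
  map_one (show Multiplicative R →* Circle from f)

theorem eval_add (q r : R) (f : CharGroup R) : eval R (q + r) f = eval R q f * eval R r f :=
  map_mul (show Multiplicative R →* Circle from f) _ _

theorem range_eval : range (fun (f : CharGroup R) (q : R) => eval R q f) =
    {g | g 0 = 1 ∧ ∀ q r, g (q + r) = g q * g r} := by
  ext g
  constructor
  · rintro ⟨f, rfl⟩
    exact ⟨eval_zero R f, fun q r => eval_add R q r f⟩
  · rintro ⟨h0, h⟩
    exact ⟨(⟨⟨fun q => g q.toAdd, h0⟩, fun q r => h _ _⟩ : Multiplicative R →* Circle), rfl⟩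

instance : CompactSpace (CharGroup R) := by
  have hclosed : IsClosed (range (fun (f : CharGroup R) (q : R) => eval R q f)) := by
    rw [range_eval, ofPred_and, ofPred_forall]
    refine (isClosed_eq (continuous_apply _) continuous_const).inter
      (isClosed_iInter fun q => ?_)
    rw [ofPred_forall]
    exact isClosed_iInter fun r => isClosed_eq (continuous_apply _)
      ((continuous_apply q).mul (continuous_apply r))
  exact (Topology.IsClosedEmbedding.mk ⟨isInducing_eval R,
    fun _ _ h => ext fun q => congrFun h q⟩ hclosed).compactSpace

noncomputable instance : MeasurableSpace (CharGroup R) := borel _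

instance : BorelSpace (CharGroup R) := ⟨rfl⟩

theorem dist_mul_mul_left (a b c : CharGroup R) : dist (a * b) (a * c) = dist b c := by
  let : Encodable R := Encodable.ofCountable R
  have h : ∀ f g : CharGroup R, dist f g =
      ∑' q, min (2⁻¹ ^ Encodable.encode q) (dist (eval R q f) (eval R q g)) :=
    fun f g => PiCountable.dist_eq_tsum (fun q => eval R q f) (fun q => eval R q g)
  have hd : ∀ x y z : Circle, dist (x * y) (x * z) = dist y z := fun x y z => by
    change dist ((x * y : Circle) : ℂ) ((x * z : Circle) : ℂ) = dist (y : ℂ) (z : ℂ)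
    rw [dist_eq_norm, dist_eq_norm, Circle.coe_mul, Circle.coe_mul, ← mul_sub, norm_mul,
      Circle.norm_coe, one_mul]
  simp_rw [h, map_mul, hd]

/-- Precomposition with multiplication by a unit. -/
noncomputable def mulUnit (u : Rˣ) : CharGroup R ≃ₜ* CharGroup R :=
  let F (v : R) (f : CharGroup R) : CharGroup R :=
    (show Multiplicative R →* Circle from f).comp (AddMonoidHom.toMultiplicative
      (AddMonoidHom.mulLeft v))
  have hF (v : R) : Continuous (F v) := (continuous_iff R).2 fun q => continuous_eval R (v * q)
  have hFF (v w : R) (h : w * v = 1) (f : CharGroup R) : F v (F w f) = f := ext fun q => by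
    change eval R (w * (v * q)) f = _
    rw [← mul_assoc, h, one_mul]
  { toFun := F u
    invFun := F ↑u⁻¹
    left_inv := hFF _ _ u.mul_inv
    right_inv := hFF _ _ u.inv_mul
    map_mul' := fun _ _ => rfl
    continuous_toFun := hF _
    continuous_invFun := hF _ }

theorem eval_mulUnit (u : Rˣ) (q : R) (f : CharGroup R) :
    eval R q (mulUnit R u f) = eval R (u * q) f := rfl

theorem exists_eval_ne_one {q : R} (hq : q ≠ 0) : ∃ f, eval R q f ≠ 1 := by
  -- Chosen so that the value at `q` is `exp(iπ) = -1`.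
  let t : ℝ := Real.pi / ((q : ℚ) : ℝ)
  let f : CharGroup R := (⟨⟨fun r => Circle.exp (((r.toAdd : R) : ℚ) * t), by simp⟩, fun r s => by
    simp [add_mul, Circle.exp_add]⟩ : Multiplicative R →* Circle)
  refine ⟨f, ?_⟩
  change Circle.exp (((q : ℚ) : ℝ) * t) ≠ 1
  rw [mul_div_cancel₀ _ (Rat.cast_ne_zero.2 fun h => hq (Subtype.ext h))]
  exact Circle.exp_pi_ne_one

end CharGroup

/-- The integral of a nontrivial character vanishes. -/
theorem integral_character_eq_zero {G : Type*} [Group G] [TopologicalSpace G] [MeasurableSpace G]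
    [IsTopologicalGroup G] [BorelSpace G]
    {μ : Measure G} [μ.IsMulLeftInvariant] {χ : G →ₜ* Circle} (hχ : χ ≠ 1) :
    ∫ x, (χ x : ℂ) ∂μ = 0 := by
  obtain ⟨a, ha⟩ : ∃ a, χ a ≠ 1 := by
    by_contra! h
    exact hχ (ContinuousMonoidHom.ext h)
  have h := integral_mul_left_eq_self (μ := μ) (fun x => (χ x : ℂ)) a
  simp only [map_mul, Circle.coe_mul] at h
  rw [integral_const_mul, ← sub_eq_zero, ← sub_one_mul, mul_eq_zero] at h
  refine h.resolve_left fun h => ha (Circle.ext ?_)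
  rw [Circle.coe_one]
  exact sub_eq_zero.1 h

/-- A subgroup of the dual of a compact abelian group that separates points is everything. -/
theorem mem_of_separatesPoints {G : Type*} [CommGroup G] [TopologicalSpace G]
    [IsTopologicalGroup G] [CompactSpace G] [T2Space G] (Γ : Subgroup (G →ₜ* Circle))
    (hΓ : ∀ x y : G, x ≠ y → ∃ χ ∈ Γ, χ x ≠ χ y) (χ : G →ₜ* Circle) : χ ∈ Γ := by
  by_contra hχ
  borelize G
  let μ : Measure G := Measure.haarMeasure ⊤
  have : IsProbabilityMeasure μ :=
    ⟨by simpa [μ] using Measure.haarMeasure_self (K₀ := (⊤ : TopologicalSpace.PositiveCompacts G))⟩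
  let toC (ψ : G →ₜ* Circle) : C(G, ℂ) := ⟨fun x => (ψ x : ℂ), by fun_prop⟩
  have htoC : ∀ ψ x, toC ψ x = (ψ x : ℂ) := fun _ _ => rfl
  have hint : ∀ f : C(G, ℂ), Integrable (fun x => f x * (χ⁻¹ x : Circle)) μ := fun f =>
    ((map_continuous f).mul (map_continuous (toC χ⁻¹))).integrable_of_hasCompactSupport
      (HasCompactSupport.of_compactSpace _)
  -- Pairing with `χ` kills every character in `Γ`, by orthogonality. Stone–Weierstrass makes their
  -- span dense, so `Λ = 0`, yet `Λ` is `1` at `χ`.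
  let Λ : C(G, ℂ) →L[ℂ] ℂ := LinearMap.mkContinuous
    { toFun := fun f => ∫ x, f x * (χ⁻¹ x : Circle) ∂μ
      map_add' := fun f g => by
        simp only [ContinuousMap.add_apply, add_mul]
        exact integral_add (hint f) (hint g)
      map_smul' := fun c f => by
        simp only [ContinuousMap.smul_apply, smul_eq_mul, mul_assoc, integral_const_mul,
          RingHom.id_apply] } 1 fun f => by
      have := norm_integral_le_of_norm_le_const (μ := μ) (C := ‖f‖)
        (f := fun x => f x * (χ⁻¹ x : Circle)) (Eventually.of_forall fun x => by
          rw [norm_mul, Circle.norm_coe, mul_one]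
          exact f.norm_coe_le_norm x)
      simpa using this
  have hΛ : ∀ f, Λ f = ∫ x, f x * (χ⁻¹ x : Circle) ∂μ := fun _ => rfl
  have hmul : ∀ ψ φ, toC (ψ * φ) = toC ψ * toC φ := fun _ _ => by
    ext x
    exact Circle.coe_mul _ _
  have hone : toC 1 = 1 := rfl
  let M : Submonoid C(G, ℂ) :=
    { carrier := toC '' Γ
      one_mem' := ⟨1, Γ.one_mem, hone⟩
      mul_mem' := by
        rintro _ _ ⟨ψ, hψ, rfl⟩ ⟨φ, hφ, rfl⟩
        exact ⟨ψ * φ, Γ.mul_mem hψ hφ, hmul ψ φ⟩ }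
  have hstar : ∀ f ∈ M, star f ∈ M := by
    rintro _ ⟨ψ, hψ, rfl⟩
    refine ⟨ψ⁻¹, Γ.inv_mem hψ, ?_⟩
    ext x
    exact Circle.coe_inv_eq_conj _
  let A : StarSubalgebra ℂ C(G, ℂ) :=
    { Algebra.adjoin ℂ (M : Set C(G, ℂ)) with
      star_mem' := by
        change Algebra.adjoin ℂ (M : Set C(G, ℂ)) ≤ star (Algebra.adjoin ℂ (M : Set C(G, ℂ)))
        exact Algebra.adjoin_le fun f hf => Algebra.subset_adjoin (hstar f hf) }
  have hA : ∀ f ∈ A, Λ f = 0 := by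
    intro f hf
    have hle : Submodule.span ℂ (M : Set C(G, ℂ)) ≤ LinearMap.ker (Λ : C(G, ℂ) →ₗ[ℂ] ℂ) := by
      refine Submodule.span_le.2 ?_
      rintro _ ⟨ψ, hψ, rfl⟩
      have hne : ψ * χ⁻¹ ≠ 1 := fun h => hχ (mul_inv_eq_one.1 h ▸ hψ)
      change Λ (toC ψ) = 0
      rw [hΛ, ← integral_character_eq_zero (μ := μ) hne]
      exact integral_congr_ae (Eventually.of_forall fun x => (Circle.coe_mul _ _).symm)
    have hf' : f ∈ Subalgebra.toSubmodule (Algebra.adjoin ℂ (M : Set C(G, ℂ))) := hf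
    rw [Algebra.adjoin_eq_span, Submonoid.closure_eq] at hf'
    exact hle hf'
  have hsep : A.SeparatesPoints := by
    intro x y hxy
    obtain ⟨ψ, hψ, hne⟩ := hΓ x y hxy
    exact ⟨_, ⟨toC ψ, Algebra.subset_adjoin ⟨ψ, hψ, rfl⟩, rfl⟩, fun h => hne (Circle.ext h)⟩
  have htop := ContinuousMap.starSubalgebra_topologicalClosure_eq_top_of_separatesPoints A hsep
  have hclosure : ∀ f, Λ f = 0 := fun f => by
    have hf : f ∈ closure (A : Set C(G, ℂ)) := by
      rw [← StarSubalgebra.topologicalClosure_coe, htop]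
      trivial
    exact closure_minimal (t := {f | Λ f = 0}) hA
      (isClosed_eq Λ.continuous continuous_const) hf
  have h1 := hclosure (toC χ)
  rw [hΛ] at h1
  have h2 : ∀ x, toC χ x * (χ⁻¹ x : Circle) = 1 := fun x => by
    have h3 : χ x * χ⁻¹ x = 1 := by
      change (χ * χ⁻¹) x = 1
      rw [mul_inv_cancel]
      rfl
    rw [htoC, ← Circle.coe_mul, h3, Circle.coe_one]
  simp_rw [h2] at h1
  simp at h1

namespace CompactGroupAut

/-- The dual of a subring of `ℚ` with the automorphism dual to multiplication by a unit. -/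
noncomputable def ofUnit (R : Subring ℚ) (u : Rˣ) : CompactGroupAut where
  carrier := CharGroup R
  dist_mul_mul_left := CharGroup.dist_mul_mul_left R
  T := CharGroup.mulUnit R u

/-- The evaluations identify the subring with the dual of its character group. -/
noncomputable def evalHom (R : Subring ℚ) :
    Multiplicative R →* PontryaginDual (CharGroup R) where
  toFun q := (⟨CharGroup.eval R q.toAdd, CharGroup.continuous_eval R _⟩ : CharGroup R →ₜ* Circle)
  map_one' := PontryaginDual.ext (CharGroup.eval_zero R)
  map_mul' q r := PontryaginDual.ext (CharGroup.eval_add R q.toAdd r.toAdd)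

theorem evalHom_bijective (R : Subring ℚ) : Function.Bijective (evalHom R) := by
  constructor
  · rw [injective_iff_map_eq_one]
    intro q hq
    by_contra hne
    obtain ⟨f, hf⟩ := CharGroup.exists_eval_ne_one R (q := q.toAdd) hne
    exact hf (congrArg (fun χ : PontryaginDual (CharGroup R) => χ f) hq)
  · intro χ
    refine mem_of_separatesPoints (evalHom R).range (fun f g hfg => ?_) χ
    by_contra! h
    exact hfg (CharGroup.ext fun q => h _ ⟨Multiplicative.ofAdd q, rfl⟩)

/-- The dual of `ofUnit R u` is `R`. -/
noncomputable def dualSubringOfUnit (R : Subring ℚ) (u : Rˣ) : (ofUnit R u).DualSubring R u where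
  equiv := MulEquiv.ofBijective (evalHom R) (evalHom_bijective R)
  equiv_T q f := CharGroup.eval_mulUnit R u q f

theorem ofUnit_mem_subringSolenoids (R : Subring ℚ) (u : Rˣ) : ofUnit R u ∈ subringSolenoids :=
  ⟨R, ⟨(dualSubringOfUnit R u).equiv.symm⟩⟩

end CompactGroupAut

/-! ### Counting isomorphism classes. -/

namespace Subring

/-- The rational numbers whose denominators have all their prime factors in `P`. -/
def ofPrimes (P : Set ℕ) : Subring ℚ where
  carrier := {q | ∀ p : ℕ, p.Prime → p ∣ q.den → p ∈ P}
  mul_mem' := fun {a b} ha hb p hp hd =>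
    (hp.dvd_mul.1 (hd.trans (Rat.mul_den_dvd a b))).elim (ha p hp) (hb p hp)
  one_mem' := fun _ hp hd => absurd (Nat.dvd_one.1 hd) hp.ne_one
  add_mem' := fun {a b} ha hb p hp hd =>
    (hp.dvd_mul.1 (hd.trans (Rat.add_den_dvd a b))).elim (ha p hp) (hb p hp)
  zero_mem' := fun _ hp hd => absurd (Nat.dvd_one.1 hd) hp.ne_one
  neg_mem' := fun ha p hp hd => ha p hp hd

theorem mem_ofPrimes {P : Set ℕ} {q : ℚ} :
    q ∈ ofPrimes P ↔ ∀ p : ℕ, p.Prime → p ∣ q.den → p ∈ P := Iff.rfl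

theorem inv_mem_ofPrimes_iff {P : Set ℕ} {p : ℕ} (hp : p.Prime) :
    (p : ℚ)⁻¹ ∈ ofPrimes P ↔ p ∈ P := by
  rw [mem_ofPrimes, Rat.inv_natCast_den_of_pos hp.pos]
  refine ⟨fun h => h p hp dvd_rfl, fun h l hl hd => ?_⟩
  rwa [(Nat.prime_dvd_prime_iff_eq hl hp).1 hd]

end Subring

namespace CompactGroupAut

theorem DualSubring.subring_eq_of_algIso {X Y : CompactGroupAut} {R S : Subring ℚ} {u : Rˣ}
    {v : Sˣ} (D : X.DualSubring R u) (D' : Y.DualSubring S v) (h : AlgIso X Y) : R = S := by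
  obtain ⟨φ, -⟩ := h
  let F : X.carrier →ₜ* Y.carrier := φ
  let F' : Y.carrier →ₜ* X.carrier := φ.symm
  let E : PontryaginDual X.carrier ≃* PontryaginDual Y.carrier :=
    { toFun := PontryaginDual.map F'
      invFun := PontryaginDual.map F
      left_inv := fun χ => PontryaginDual.ext fun x => congrArg χ (φ.symm_apply_apply x)
      right_inv := fun χ => PontryaginDual.ext fun x => congrArg χ (φ.apply_symm_apply x)
      map_mul' := fun _ _ => rfl }
  exact Subring.eq_of_addEquiv
    (MulEquiv.toAdditive ((D.equiv.trans E).trans D'.equiv.symm) : R ≃+ S)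

theorem finite_setOf_height_eq (R : Subring ℚ) (h : ℤ) :
    {u : Rˣ | DualSubring.height u = h}.Finite := by
  let f (u : Rˣ) : ℤ × ℤ := (((u : R) : ℚ).num, ((u : R) : ℚ).den)
  refine Set.Finite.of_finite_image (f := f)
    (((finite_Icc (-h) h).prod (finite_Icc (-h) h)).subset ?_) ?_
  · rintro _ ⟨u, rfl, rfl⟩
    exact ⟨abs_le.1 (le_max_left _ _), abs_le.1 (le_max_right _ _)⟩
  · intro u _ v _ huv
    have h1 := congrArg Prod.fst huv
    have h2 : (((u : R) : ℚ).den : ℤ) = ((v : R) : ℚ).den := congrArg Prod.snd huv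
    exact Units.ext (Subtype.ext (Rat.ext h1 (by exact_mod_cast h2)))

/-- A system with the given zeta function is isomorphic to one of the models over a fixed ring. -/
theorem DualSubring.exists_algIso_ofUnit {X Y : CompactGroupAut} {R : Subring ℚ} {u : Rˣ}
    (D : X.DualSubring R u) (hX : X.HasZeta) (hY : Y ∈ subringSolenoids) (hYζ : Y.HasZeta)
    (h : Y.zeta = X.zeta) : ∃ v : Rˣ, Nonempty (Y.DualSubring R v) ∧ AlgIso (ofUnit R v) Y := by
  obtain ⟨S, v, ⟨D'⟩⟩ := exists_dualSubring hY
  obtain rfl := D.subring_eq_of_zeta_eq D' hX hYζ h.symm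
  exact ⟨v, ⟨D'⟩, (dualSubringOfUnit R v).algIso D'⟩

theorem not_countable_isoClasses_entropy_eq {X : CompactGroupAut} (hX : X ∈ subringSolenoids) :
    ¬ (isoClasses {Y | Y ∈ subringSolenoids ∧ Y.entropy = X.entropy}).Countable := by
  obtain ⟨R, u, ⟨D⟩⟩ := exists_dualSubring hX
  set q : ℚ := ((u : R) : ℚ) with hq
  have hq0 : q ≠ 0 := fun h => u.ne_zero (Subtype.ext h)
  -- The primes above `N` divide neither numerator nor denominator of `q`, so inverting them or not
  -- is a free choice.
  let N := q.num.natAbs + q.den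
  let prime (a : ℕ) : ℕ := Nat.nth Nat.Prime (N + a)
  have hprime : ∀ a, (prime a).Prime := fun a => Nat.prime_nth_prime _
  have hinj : Function.Injective prime := fun a b h =>
    Nat.add_left_cancel (Nat.nth_injective Nat.infinite_setOfPred_prime h)
  have hlt : ∀ a, N < prime a := fun a => by
    have h : N + a + 2 ≤ prime a := Nat.add_two_le_nth_prime (N + a)
    exact lt_of_lt_of_le (by omega) h
  -- The divisors of numerator and denominator are always included, so that `q` stays a unit; `A`
  -- selects the additional primes.
  let P (A : Set ℕ) : Set ℕ := {p | p ∣ q.num.natAbs ∨ p ∣ q.den} ∪ prime '' A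
  have hP : ∀ A a, prime a ∈ P A ↔ a ∈ A := by
    intro A a
    constructor
    · rintro ((h | h) | ⟨b, hb, hab⟩)
      · have h1 := Nat.le_of_dvd (Int.natAbs_pos.2 (Rat.num_ne_zero.2 hq0)) h
        have h2 := hlt a
        omega
      · have h1 := Nat.le_of_dvd q.den_pos h
        have h2 := hlt a
        omega
      · exact hinj hab ▸ hb
    · exact fun h => Or.inr ⟨a, h, rfl⟩
  let ring (A : Set ℕ) : Subring ℚ := Subring.ofPrimes (P A)
  have hmem : ∀ A, q ∈ ring A := fun A p _ hd => Or.inl (Or.inr hd)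
  have hinv : ∀ A, q⁻¹ ∈ ring A := fun A p _ hd => Or.inl (Or.inl (by
    rwa [Rat.den_inv_of_ne_zero hq0] at hd))
  let unit (A : Set ℕ) : (ring A)ˣ := ⟨⟨q, hmem A⟩, ⟨q⁻¹, hinv A⟩,
    Subtype.ext (mul_inv_cancel₀ hq0), Subtype.ext (inv_mul_cancel₀ hq0)⟩
  let f (A : Set ℕ) : Quotient algIsoSetoid := Quotient.mk _ (ofUnit (ring A) (unit A))
  have hf : Function.Injective f := by
    intro A B hAB
    have hR : ring A = ring B := (dualSubringOfUnit _ (unit A)).subring_eq_of_algIso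
      (dualSubringOfUnit _ (unit B)) (Quotient.exact hAB)
    ext a
    rw [← hP A, ← hP B, ← Subring.inv_mem_ofPrimes_iff (hprime a),
      ← Subring.inv_mem_ofPrimes_iff (hprime a)]
    exact iff_of_eq (congrArg (((prime a : ℕ) : ℚ)⁻¹ ∈ ·) hR)
  have hmaps : ∀ A, f A ∈ isoClasses {Y | Y ∈ subringSolenoids ∧ Y.entropy = X.entropy} :=
    fun A => ⟨_, ⟨ofUnit_mem_subringSolenoids _ _, by
      rw [(dualSubringOfUnit _ (unit A)).entropy_eq, D.entropy_eq]
      rfl⟩, rfl⟩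
  intro hc
  have : Countable (Set ℕ) := countable_univ_iff.1
    (MapsTo.countable_of_injOn (fun A _ => hmaps A) hf.injOn hc)
  obtain ⟨g, hg⟩ := exists_injective_nat (Set ℕ)
  exact Function.cantor_injective g hg

end CompactGroupAut

theorem mainTheorem2 :
    (∀ X ∈ CompactGroupAut.subringSolenoids,
      ¬ (CompactGroupAut.isoClasses {Y | Y ∈ CompactGroupAut.subringSolenoids ∧
          Y.entropy = X.entropy}).Countable) ∧
    (∀ X ∈ CompactGroupAut.subringSolenoids, X.HasZeta →
      (CompactGroupAut.isoClasses {Y | Y ∈ CompactGroupAut.subringSolenoids ∧ Y.HasZeta ∧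
          Y.zeta = X.zeta}).Countable) ∧
    (∀ X ∈ CompactGroupAut.subringSolenoids, X.HasZeta →
      (CompactGroupAut.isoClasses {Y | Y ∈ CompactGroupAut.subringSolenoids ∧ Y.HasZeta ∧
          Y.entropy = X.entropy ∧ Y.zeta = X.zeta}).Finite) := by
  refine ⟨fun X hX => CompactGroupAut.not_countable_isoClasses_entropy_eq hX,
    fun X hX hζ => ?_, fun X hX hζ => ?_⟩
  · obtain ⟨R, u, ⟨D⟩⟩ := CompactGroupAut.exists_dualSubring hX
    have : Countable Rˣ := (Units.val_injective (α := R)).countable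
    refine (countable_range fun v : Rˣ => (Quotient.mk CompactGroupAut.algIsoSetoid
      (CompactGroupAut.ofUnit R v))).mono ?_
    rintro _ ⟨Y, ⟨hY, hYζ, h⟩, rfl⟩
    obtain ⟨v, -, hv⟩ := D.exists_algIso_ofUnit hζ hY hYζ h
    exact ⟨v, Quotient.sound hv⟩
  · obtain ⟨R, u, ⟨D⟩⟩ := CompactGroupAut.exists_dualSubring hX
    refine ((CompactGroupAut.finite_setOf_height_eq R
      (CompactGroupAut.DualSubring.height u)).image fun v : Rˣ =>
        (Quotient.mk CompactGroupAut.algIsoSetoid (CompactGroupAut.ofUnit R v))).subset ?_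
    rintro _ ⟨Y, ⟨hY, hYζ, he, h⟩, rfl⟩
    obtain ⟨v, ⟨D'⟩, hv⟩ := D.exists_algIso_ofUnit hζ hY hYζ h
    refine ⟨v, ?_, Quotient.sound hv⟩
    rw [D.entropy_eq, D'.entropy_eq, EReal.coe_eq_coe_iff] at he
    have := Real.log_injOn_pos
      (mem_Ioi.2 (Int.cast_pos.2 (CompactGroupAut.DualSubring.height_pos v)))
      (mem_Ioi.2 (Int.cast_pos.2 (CompactGroupAut.DualSubring.height_pos u))) he
    exact_mod_cast this
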